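/- Let $K$ be a totally real field, i.e. a (possibly infinite) algebraic extension of $\mathbb{Q}$ all of whose embeddings into $\mathbb{C}$ have image in $\mathbb{R}$, with ring of integers $\mathcal{O}$ and algebraic closure $\bar K$; let $\mu_\infty\subset\bar K^\times$ be the group of roots of unity. A \emph{root lattice} over $\mathcal{O}$ is a nonzero finitely generated free $\mathcal{O}$-module $L$ with a symmetric $\mathcal{O}$-bilinear form $L\times L\to\mathcal{O}$, $(x,y)\mapsto x\cdot y$, which is totally positive definite ($\sigma(x\cdot x)>0$ for all $x\ne0$ and all embeddings $\sigma\colon K\hookrightarrow\mathbb{R}$), such that $L$ is generated by its set of roots $\Phi(L)=\{x\in L\mid x\cdot x=2\}$. Isomorphisms are $\mathcal{O}$-linear isometries. $L$ is \emph{irreducible} if it is not the orthogonal direct sum of two nonzero (finitely generated free) sublattices. Let $\mu(L)\le\mu_\infty$ be the subgroup generated by $\{\zeta\in\mu_\infty\mid \zeta+\zeta^{-1}=\alpha\cdot\beta\text{ for some }\alpha,\beta\in\Phi(L)\}$. Let $\zeta_{k}\in\bar K$ denote a primitive $k$-th root of unity and let $Q_K=\{n>1\mid \zeta_{2n}+\zeta_{2n}^{-1}\in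 K\}$, regarded as a directed graph with an edge $x\to y$ if $x\mid y$ and $y/x$ is prime. Write $x\preceq y$ if there is a directed path from $x$ to $y$, and $\pi_0(Q_K)$ for the set of connected components. Put $$\mathcal{P}_K=\{\{q\}\mid q\in Q_K\text{ a prime power}\},\qquad \mathcal{R}_K=\{C\in\pi_0(Q_K)\mid C\text{ contains an integer that is not a prime power}\},$$ and for $C\subset Q_K$ let $\mu(C)\le\mu_\infty$ be the subgroup generated by $\{\zeta_{2n}\mid n\in C\}$. **Theorem.** (1) For every root lattice $L$ of rank $2$ over $\mathcal{O}$ there is $C\in\mathcal{P}_K\cup\mathcal{R}_K$ with $\mu(L)=\mu(C)$. (2) For every $C\in\mathcal{P}_K\cup\mathcal{R}_K$ there is a root lattice $L$ of rank $2$ over $\mathcal{O}$ with $\mu(L)=\mu(C)$. (3) The map $L\mapsto\mu(L)$ induces a bijection from the set of isomorphism classes of root lattices of rank $2$ over $\mathcal{O}$ onto $\{\mu(C)\mid C\in\mathcal{P}_K\cup\mathcal{R}_K\}$; moreover $C\mapsto\mu(C)$ is injective on $\mathcal{P}_K\cup\mathcal{R}_K$. (4) Suppose $[K:\mathbb{Q}]<\infty$,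 fix an embedding $K\hookrightarrow\mathbb{R}$, and let $m\ge3$. Then $m\in Q_K$ if and only if $2\cos(\pi/m)\in K$, and there exists an irreducible root lattice over $\mathcal{O}$ of type $I_2(m)$ if and only if $m\in Q_K$ and $m$ is a prime power or a maximal element of $Q_K$ for $\preceq$. Here $L$ is of type $I_2(m)$ if it has a fundamental system of roots $\{\alpha,\beta\}$ consisting of two roots with $\alpha\cdot\beta=-2\cos(\pi/m)$ (so $I_2(3)=A_2$, $I_2(4)=B_2$), where a fundamental system is a set $\Delta\subset\Phi(L)$ which is a basis of $L\otimes_{\mathcal{O}}K$ and such that every root is $\sum_{\beta\in\Delta}c_\beta\beta$ with all $c_\beta\in\mathcal{O}_{\ge1}\cup\{0\}$ or all $-c_\beta\in\mathcal{O}_{\ge1}\cup\{0\}$; $\mathcal{O}_{\ge1}$ is the set of elements of $\mathcal{O}$ that are at least $1$ in the fixed embedding. -/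

import Mathlib

open scoped NumberField TensorProduct

universe u

namespace RootLat

/-! ### Root lattices -/

/-- A root lattice over the ring of integers `𝓞 K` of `K`: a nonzero finitely generated free
`𝓞 K`-module with a symmetric, totally positive definite (hence non-degenerate) `𝓞 K`-valued
bilinear form, generated by its vectors of norm `2`. -/
structure RootLattice (K : Type u) [Field K] where
  carrier : Type u
  [addCommGroup : AddCommGroup carrier]
  [module : Module (𝓞 K) carrier]
  [nontrivial : Nontrivial carrier]
  [free : Module.Free (𝓞 K) carrier]
  [finite : Module.Finite (𝓞 K) carrier]
  form : LinearMap.BilinForm (𝓞 K) carrier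
  symm : ∀ x y, form x y = form y x
  totally_pos : ∀ σ : K →+* ℝ, ∀ x, x ≠ 0 → 0 < σ (form x x : K)
  span_roots : Submodule.span (𝓞 K) {x | form x x = 2} = ⊤

namespace RootLattice

attribute [instance] addCommGroup module nontrivial free finite

variable {K : Type u} [Field K]

/-- The set of roots of `L`. -/
def roots (L : RootLattice K) : Set L.carrier := {x | L.form x x = 2}

/-- The rank of `L` over `𝓞 K`. -/
noncomputable def rank (L : RootLattice K) : ℕ := Module.finrank (𝓞 K) L.carrier

/-- `L` and `M` are isomorphic: there is an `𝓞 K`-linear isometry from `L` onto `M`. -/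
def Isom (L M : RootLattice K) : Prop :=
  ∃ e : L.carrier ≃ₗ[𝓞 K] M.carrier, ∀ x y, M.form (e x) (e y) = L.form x y

/-- `L` is reducible: it is the orthogonal direct sum of two nonzero lattices. -/
def Reducible (L : RootLattice K) : Prop :=
  ∃ L₁ L₂ : Submodule (𝓞 K) L.carrier,
    L₁ ≠ ⊥ ∧ L₂ ≠ ⊥ ∧
    Module.Free (𝓞 K) L₁ ∧ Module.Finite (𝓞 K) L₁ ∧
    Module.Free (𝓞 K) L₂ ∧ Module.Finite (𝓞 K) L₂ ∧
    IsCompl L₁ L₂ ∧ ∀ x ∈ L₁, ∀ y ∈ L₂, L.form x y = 0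

/-- `L` is irreducible. -/
def Irreducible (L : RootLattice K) : Prop := ¬ L.Reducible

/-- `Δ` is a fundamental system of roots of `L`, with respect to the order on `K` induced by the
real embedding `φ`: it consists of roots, it is a basis of the vector space `K ⊗ L`, and every root
is a linear combination of `Δ` whose coefficients all lie in `𝓞_{≥ 1} ∪ {0}`, or whose
coefficients all have their negatives there. -/
def IsFundamentalSystem (φ : K →+* ℝ) (L : RootLattice K) (Δ : Set L.carrier) : Prop :=
  Δ ⊆ L.roots ∧
  LinearIndepOn K (fun x : L.carrier => (1 : K) ⊗ₜ[𝓞 K] x) Δ ∧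
  Submodule.span K ((fun x : L.carrier => (1 : K) ⊗ₜ[𝓞 K] x) '' Δ) = ⊤ ∧
  ∀ α ∈ L.roots, ∃ c : Δ →₀ 𝓞 K,
    (c.sum fun β a => a • (β : L.carrier)) = α ∧
    ((∀ β, c β = 0 ∨ 1 ≤ φ (c β : K)) ∨ (∀ β, c β = 0 ∨ 1 ≤ φ (-(c β : K))))

/-- `L` is of type `I₂(m)`: it has a fundamental system of two roots `α`, `β` with
`α · β = -2 cos (π / m)`, so that its Coxeter-Dynkin diagram consists of two vertices joined by an
edge labelled `m` (types `A₂` and `B₂` being `I₂(3)` and `I₂(4)`). -/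
def IsOfTypeI₂ (φ : K →+* ℝ) (L : RootLattice K) (m : ℕ) : Prop :=
  ∃ α β : L.carrier, α ≠ β ∧ L.IsFundamentalSystem φ {α, β} ∧
    φ (L.form α β : K) = -2 * Real.cos (Real.pi / m)

/-- The group `μ(L)`: the group of roots of unity (in an algebraic closure of `K`) generated by
those `ζ` for which `ζ + ζ⁻¹` is the inner product of two roots of `L`. -/
noncomputable def mu (L : RootLattice K) : Subgroup (AlgebraicClosure K)ˣ :=
  Subgroup.closure {ζ | IsOfFinOrder ζ ∧ ∃ α ∈ L.roots, ∃ β ∈ L.roots,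
    (ζ : AlgebraicClosure K) + (ζ : AlgebraicClosure K)⁻¹ =
      algebraMap K (AlgebraicClosure K) (L.form α β : K)}

theorem Isom.refl (L : RootLattice K) : Isom L L := ⟨LinearEquiv.refl _ _, fun _ _ => rfl⟩

theorem Isom.symm {L M : RootLattice K} (h : Isom L M) : Isom M L := by
  obtain ⟨e, he⟩ := h
  exact ⟨e.symm, fun x y => by simpa using (he (e.symm x) (e.symm y)).symm⟩

theorem Isom.trans {L M N : RootLattice K} (h : Isom L M) (h' : Isom M N) : Isom L N := by
  obtain ⟨e, he⟩ := h
  obtain ⟨f, hf⟩ := h'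
  exact ⟨e.trans f, fun x y => by simp [he, hf]⟩

theorem Isom.mu_le {L M : RootLattice K} (h : Isom L M) : L.mu ≤ M.mu := by
  obtain ⟨e, he⟩ := h
  refine Subgroup.closure_mono ?_
  rintro ζ ⟨hζ, α, hα, β, hβ, h⟩
  refine ⟨hζ, e α, ?_, e β, ?_, ?_⟩
  · simpa [roots, he] using hα
  · simpa [roots, he] using hβ
  · rw [he]; exact h

theorem Isom.mu_eq {L M : RootLattice K} (h : Isom L M) : L.mu = M.mu :=
  le_antisymm h.mu_le h.symm.mu_le

end RootLattice

/-- Isomorphism of root lattices of rank `2`, as an equivalence relation. -/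
instance rankTwoSetoid (K : Type u) [Field K] : Setoid {L : RootLattice K // L.rank = 2} where
  r L M := L.1.Isom M.1
  iseqv := ⟨fun L => .refl L.1, fun h => h.symm, fun h h' => h.trans h'⟩

/-- The isomorphism classes of root lattices of rank `2` over `𝓞 K`. -/
def RankTwoClasses (K : Type u) [Field K] : Type (u + 1) := Quotient (rankTwoSetoid K)

/-- The map `L ↦ μ(L)` on isomorphism classes. -/
noncomputable def RankTwoClasses.mu {K : Type u} [Field K] :
    RankTwoClasses K → Subgroup (AlgebraicClosure K)ˣ :=
  Quotient.lift (fun L => L.1.mu) fun _ _ h => RootLattice.Isom.mu_eq h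

/-! ### The directed graph `Q_K` -/

section Graph

variable (K : Type u) [Field K]

/-- The set `Q_K` of all `n > 1` with `ζ + ζ⁻¹ ∈ K`, where `ζ` is a primitive `2n`-th root of
unity. -/
def Q : Set ℕ :=
  {n | 1 < n ∧ ∃ ζ : AlgebraicClosure K, IsPrimitiveRoot ζ (2 * n) ∧
    ζ + ζ⁻¹ ∈ Set.range (algebraMap K (AlgebraicClosure K))}

/-- The directed graph on `Q_K`, with an edge from `x` to `y` if `x` divides `y` and `y / x` is a
prime number. -/
def digraphQ : Digraph (Q K) where
  Adj x y := (x : ℕ) ∣ y ∧ ((y : ℕ) / x).Prime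

/-- The partial order on `Q_K`: there is a directed path from `x` to `y`. -/
def Prec (x y : Q K) : Prop := Relation.ReflTransGen (digraphQ K).Adj x y

/-- `m` is a maximal element of `Q_K`. -/
def IsMaximalInQ (m : ℕ) : Prop := ∃ h : m ∈ Q K, ∀ y : Q K, Prec K ⟨m, h⟩ y → (y : ℕ) = m

/-- The (vertex sets of the) connected components of `Q_K`, edge directions being ignored. -/
def components : Set (Set ℕ) :=
  {C | ∃ c : (digraphQ K).toSimpleGraphInclusive.ConnectedComponent, C = Subtype.val '' c.supp}

/-- The set `𝒫_K` of all `{q}` with `q ∈ Q_K` a prime power. -/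
def setP : Set (Set ℕ) := {C | ∃ q ∈ Q K, IsPrimePow q ∧ C = {q}}

/-- The set `ℛ_K` of the components of `Q_K` that contain a number that is not a prime power. -/
def setR : Set (Set ℕ) := {C | C ∈ components K ∧ ∃ n ∈ C, ¬ IsPrimePow n}

/-- The group `μ(C)`, generated by the primitive `2n`-th roots of unity for `n ∈ C`. -/
noncomputable def muOf (C : Set ℕ) : Subgroup (AlgebraicClosure K)ˣ :=
  Subgroup.closure {ζ | ∃ n ∈ C, IsPrimitiveRoot ζ (2 * n)}

end Graph

end RootLat

/-! A root lattice of rank two is a lattice spanned by roots of unity. If `α` and `β ≠ ±α` are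
roots, total positivity gives `|σ(α·β)| < 2` for every real embedding `σ`, so a solution `ζ` of `ζ +
ζ⁻¹ = α·β` is an algebraic integer whose conjugates all have absolute value one; by Kronecker it is
a root of unity. Sending `α` to `1` and `β` to `ζ` embeds `L` in the algebraic closure, with form `x
ȳ + x̄ y` (`exists_realization`). The roots of `L` are then exactly the roots of unity in the image.
Stability under reflections makes them a group, which is `μ(L)` (`mem_mu_iff`); as they span `L`,
the group determines `L`.

It remains to see which groups occur. Let `w ∈ μ(L)` be a primitive `2n`-th root of unity, `n > 1`.
If `n` is not a prime power, `w - w⁻¹` is a unit, so `𝓞 + 𝓞 w` already contains every root of unity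
of `K(w)`, and `μ(L)` is as large as possible (`mu_eq_quadOf`). If no such `n` occurs, finite
generation gives `L = 𝓞 + 𝓞 w` for one `w` with `n` a prime power `q`, and then `μ(L)` has order
`2q`: a larger root of unity `v` in it would make `(v - v⁻¹) / (w - w⁻¹)` integral, which fails at
the prime dividing `q` (`eq_of_primitive_of_isIntegral`). Conversely `𝓞 + 𝓞 w` is always a root
lattice. Two members `n`, `m` of `Q_K` lie in one component if and only if primitive `2n`-th and
`2m`-th roots of unity generate the same quadratic extension of `K`, so the full groups of the first
case are the `μ(C)` with `C` in `ℛ_K`.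

For type `I₂(m)`, take `w = exp(iπ/m)` and the fundamental roots `1` and `-w⁻¹`. The coefficients of
`w ^ k` are quotients `sin(jπ/m) / sin(π/m)`, which are zero or at least one in absolute value,
while `exp(iπ/(mp))` has the coefficient `sin(π/(mp)) / sin(π/m)`, strictly between zero and one. So
`μ(L)` must not contain the latter, which for `m` not a prime power means that `m` is maximal in
`Q_K`. -/

namespace RootLat

/-! ### Roots of unity with trace in a subfield -/

section QuadGroup

variable {K F : Type*} [Field K] [Field F] [Algebra K F]

/-- Two torsion elements of a group of roots of unity lie in a common cyclic subgroup. -/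
theorem exists_primitive_lcm {G : Subgroup Fˣ} {u v : Fˣ} (hu : u ∈ G) (hv : v ∈ G)
    {a b : ℕ} (ha : IsPrimitiveRoot u a) (hb : IsPrimitiveRoot v b) (ha0 : a ≠ 0) (hb0 : b ≠ 0) :
    ∃ w ∈ G, IsPrimitiveRoot w (a.lcm b) ∧ (∃ i : ℕ, w ^ i = u) ∧ ∃ i : ℕ, w ^ i = v := by
  have h := ha.pow_mul_pow_lcm hb ha0 hb0
  have hne : NeZero (a.lcm b) := ⟨Nat.lcm_ne_zero ha0 hb0⟩
  refine ⟨_, G.mul_mem (G.pow_mem hu _) (G.pow_mem hv _), h, ?_, ?_⟩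
  · have h1 : u ^ (a.lcm b) = 1 := (ha.pow_eq_one_iff_dvd _).2 (Nat.dvd_lcm_left a b)
    obtain ⟨i, -, hi⟩ := (IsPrimitiveRoot.coe_units_iff.2 h).eq_pow_of_pow_eq_one
      (ξ := (u : F)) (by simpa using congrArg Units.val h1)
    exact ⟨i, Units.ext (by exact_mod_cast hi)⟩
  · have h1 : v ^ (a.lcm b) = 1 := (hb.pow_eq_one_iff_dvd _).2 (Nat.dvd_lcm_right a b)
    obtain ⟨i, -, hi⟩ := (IsPrimitiveRoot.coe_units_iff.2 h).eq_pow_of_pow_eq_one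
      (ξ := (v : F)) (by simpa using congrArg Units.val h1)
    exact ⟨i, Units.ext (by exact_mod_cast hi)⟩

/-- A set of torsion elements of `Fˣ` containing `1` and stable under `(x, y) ↦ x² y⁻¹` is stable
under multiplication. -/
theorem mul_mem_of_sq_mul_inv_mem {S : Set Fˣ} (h1 : 1 ∈ S)
    (hS : ∀ x ∈ S, ∀ y ∈ S, x ^ 2 * y⁻¹ ∈ S) (hfin : ∀ x ∈ S, IsOfFinOrder x)
    {x y : Fˣ} (hx : x ∈ S) (hy : y ∈ S) : x * y ∈ S := by
  have hinv : ∀ z ∈ S, z⁻¹ ∈ S := fun z hz => by simpa using hS 1 h1 z hz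
  have hsq : ∀ z ∈ S, ∀ t ∈ S, z ^ 2 * t ∈ S := fun z hz t ht => by
    simpa using hS z hz _ (hinv t ht)
  have hsqn : ∀ z ∈ S, ∀ t ∈ S, ∀ n : ℕ, z ^ (2 * n) * t ∈ S := by
    intro z hz t ht n
    induction n with
    | zero => simpa using ht
    | succ n ih =>
      have := hsq z hz _ ih
      rwa [← mul_assoc, ← pow_add, show 2 + 2 * n = 2 * (n + 1) by ring] at this
  have hsqz : ∀ z ∈ S, ∀ t ∈ S, ∀ n : ℤ, z ^ (2 * n) * t ∈ S := by
    intro z hz t ht n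
    obtain ⟨m, rfl | rfl⟩ := n.eq_nat_or_neg
    · exact_mod_cast hsqn z hz t ht m
    · have := hsqn _ (hinv z hz) t ht m
      rw [mul_neg, zpow_neg, ← inv_zpow]
      exact_mod_cast this
  -- The subgroup generated by `x` and `y` is cyclic, with generator `g = w ^ d = x ^ s * y ^ t` by
  -- Bézout; thus `x = g ^ a` and `y = g ^ b`. Even powers of `g` preserve `S`, because even powers
  -- of `x` and of `y` do.
  obtain ⟨w, -, -, ⟨i, hi⟩, ⟨j, hj⟩⟩ := exists_primitive_lcm (G := ⊤) (u := x) (v := y)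
    trivial trivial (IsPrimitiveRoot.orderOf x) (IsPrimitiveRoot.orderOf y)
    (hfin x hx).orderOf_pos.ne' (hfin y hy).orderOf_pos.ne'
  obtain ⟨a, ha⟩ := Int.gcd_dvd_left (a := (i : ℤ)) (b := (j : ℤ))
  obtain ⟨b, hb⟩ := Int.gcd_dvd_right (a := (i : ℤ)) (b := (j : ℤ))
  have hbez := Int.gcd_eq_gcd_ab (i : ℤ) j
  set d : ℤ := (Int.gcd (i : ℤ) j : ℤ)
  set s := Int.gcdA (i : ℤ) j
  set t := Int.gcdB (i : ℤ) j
  have hxw : x = (w ^ d) ^ a := by rw [← hi, ← zpow_mul, ← ha, zpow_natCast]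
  have hyw : y = (w ^ d) ^ b := by rw [← hj, ← zpow_mul, ← hb, zpow_natCast]
  have hg : w ^ d = x ^ s * y ^ t := by
    rw [← hi, ← hj, hbez, zpow_add, zpow_mul, zpow_mul, zpow_natCast, zpow_natCast]
  have key : ∀ n : ℤ, ∀ z ∈ S, (w ^ d) ^ (2 * n) * z ∈ S := by
    intro n z hz
    have := hsqz x hx _ (hsqz y hy z hz (t * n)) (s * n)
    convert this using 1
    rw [hg, mul_zpow, ← zpow_mul, ← zpow_mul, mul_assoc]
    congr 2
    · ring
    · ring_nf
  -- If `a` or `b` is even, `x * y` is an even power of `g` times an element of `S`; if both are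
  -- odd, it is an even power of `g` times `1`.
  rcases Int.even_or_odd' a with ⟨a', rfl | rfl⟩
  · rw [hxw]; exact key _ _ hy
  rcases Int.even_or_odd' b with ⟨b', rfl | rfl⟩
  · rw [mul_comm, hyw]; exact key _ _ hx
  have := key (a' + b' + 1) 1 h1
  rw [mul_one] at this
  convert this using 1
  rw [hxw, hyw, ← zpow_add]
  congr 1; ring

variable (K) in
theorem sub_inv_sq_mem {u : Fˣ} (h : (u + (u : F)⁻¹ : F) ∈ (algebraMap K F).fieldRange) :
    (u - (u : F)⁻¹ : F) ^ 2 ∈ (algebraMap K F).fieldRange := by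
  have : (u - (u : F)⁻¹ : F) ^ 2 = (u + (u : F)⁻¹ : F) ^ 2 - (4 : ℕ) := by
    have := u.ne_zero
    field_simp; push_cast; ring
  rw [this]
  exact sub_mem (pow_mem h 2) (natCast_mem _ _)

variable (K) in
/-- The group of the roots of unity in the quadratic extension `K(δ)` of `K`, where `δ² ∈ K`, whose
conjugate is their inverse. -/
def quadGroup [NeZero (2 : F)] (δ : F) (h0 : δ ≠ 0) (h2 : δ ^ 2 ∈ (algebraMap K F).fieldRange) :
    Subgroup Fˣ where
  carrier := {g | IsOfFinOrder g ∧ (g + (g : F)⁻¹ : F) ∈ (algebraMap K F).fieldRange ∧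
    (g - (g : F)⁻¹ : F) * δ ∈ (algebraMap K F).fieldRange}
  one_mem' := by
    refine ⟨IsOfFinOrder.one, ?_, by simp⟩
    simpa using add_mem (one_mem (algebraMap K F).fieldRange) (one_mem _)
  inv_mem' := by
    rintro g ⟨hg, hs, hd⟩
    refine ⟨hg.inv, by simpa [add_comm] using hs, ?_⟩
    have := neg_mem hd
    convert this using 1
    simp; ring
  mul_mem' := by
    rintro g h ⟨hg, hs, hd⟩ ⟨hg', hs', hd'⟩
    have hg0 := g.ne_zero
    have hh0 := h.ne_zero
    have h20 : (2 : F) ≠ 0 := NeZero.ne _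
    have h2i : (2 : F)⁻¹ ∈ (algebraMap K F).fieldRange := by
      have := inv_mem (natCast_mem (algebraMap K F).fieldRange 2)
      exact_mod_cast this
    refine ⟨hg.mul hg', ?_, ?_⟩
    -- With `s = g + g⁻¹` and `d = g - g⁻¹`, and likewise `s'`, `d'` for `h`, the sum for `g * h` is
    -- `(s s' + d d') / 2`, where `d d' = (d δ)(d' δ) / δ²`, and its difference is `(d s' + d' s) /
    -- 2`.
    · have := mul_mem h2i (add_mem (mul_mem hs hs')
        (mul_mem (mul_mem hd hd') (inv_mem h2)))
      convert this using 1
      push_cast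
      field_simp
      ring
    · have := mul_mem h2i (add_mem (mul_mem hd hs') (mul_mem hd' hs))
      convert this using 1
      push_cast
      field_simp
      ring

theorem mem_quadGroup [NeZero (2 : F)] {δ : F} {h0 : δ ≠ 0}
    {h2 : δ ^ 2 ∈ (algebraMap K F).fieldRange} {g : Fˣ} :
    g ∈ quadGroup K δ h0 h2 ↔ IsOfFinOrder g ∧ (g + (g : F)⁻¹ : F) ∈ (algebraMap K F).fieldRange ∧
      (g - (g : F)⁻¹ : F) * δ ∈ (algebraMap K F).fieldRange := Iff.rfl

theorem sub_inv_ne_zero {u : Fˣ} (h : u ^ 2 ≠ 1) : (u - (u : F)⁻¹ : F) ≠ 0 := by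
  intro h0
  apply h
  ext
  have hu := u.ne_zero
  field_simp at h0
  push_cast
  linear_combination h0

/-- The quotient of `u ^ k - u ^ (-k)` by `u - u ^ (-1)` is a sum of powers of `u`, stated in terms
of `u²`. -/
theorem pow_sub_inv_pow (u : Fˣ) (k : ℕ) :
    ((u : F) ^ k - ((u : F) ^ k)⁻¹) * (u : F) ^ k =
      (u - (u : F)⁻¹ : F) * u * ∑ i ∈ Finset.range k, ((u : F) ^ 2) ^ i := by
  have hu := u.ne_zero
  have h1 : (u - (u : F)⁻¹ : F) * u = (u : F) ^ 2 - 1 := by field_simp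
  rw [h1, mul_comm _ (∑ i ∈ _, _), geom_sum_mul]
  field_simp
  ring

theorem pow_mem_quadGroup_self [NeZero (2 : F)] {u : Fˣ} (hu : IsOfFinOrder u)
    (h : (u + (u : F)⁻¹ : F) ∈ (algebraMap K F).fieldRange) (h1 : u ^ 2 ≠ 1) (k : ℕ) :
    u ^ k ∈ quadGroup K (u - (u : F)⁻¹ : F) (sub_inv_ne_zero h1) (sub_inv_sq_mem K h) :=
  Subgroup.pow_mem _ (mem_quadGroup.2 ⟨hu, h, by rw [← sq]; exact sub_inv_sq_mem K h⟩) k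

end QuadGroup

/-! ### Integrality of `1 - ζ` and of cyclotomic units -/

section Integral

variable {F : Type*} [Field F]

-- The cyclotomic polynomial takes the value `1` at `1`, that is, the numbers `1 - μ` over all
-- primitive `n`-th roots `μ` have product `1`. Hence the inverse of one factor is the product of
-- the others.
open scoped Classical in
theorem isIntegral_inv_one_sub {η : F} {n : ℕ} (hη : IsPrimitiveRoot η n)
    (h1 : 1 < n) (hn : ¬ IsPrimePow n) : IsIntegral ℤ (1 - η)⁻¹ := by
  have hc := Polynomial.cyclotomic_eq_prod_X_sub_primitiveRoots hη
  have he : Polynomial.eval 1 (Polynomial.cyclotomic n F) = 1 := by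
    apply Polynomial.eval_one_cyclotomic_not_prime_pow
    rintro p hp k rfl
    apply hn
    refine hp.isPrimePow.pow ?_
    rintro rfl
    simp at h1
  rw [hc, Polynomial.eval_prod] at he
  have hmem : η ∈ primitiveRoots n F := (mem_primitiveRoots (by lia)).2 hη
  rw [← Finset.mul_prod_erase _ _ hmem] at he
  simp only [Polynomial.eval_sub, Polynomial.eval_X, Polynomial.eval_C] at he
  rw [← eq_inv_of_mul_eq_one_right he]
  refine IsIntegral.prod _ fun μ hμ => ?_
  have := (mem_primitiveRoots (by lia)).1 (Finset.mem_of_mem_erase hμ)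
  exact isIntegral_one.sub (this.isIntegral (by lia))

/-- Modulo a maximal ideal over `p`, roots of unity of `p`-power order become trivial. -/
theorem mk_eq_one_of_pow_prime_pow {p : ℕ} (hp : p.Prime) {M : Ideal (integralClosure ℤ F)}
    (hM : M.IsMaximal) (hpM : (p : integralClosure ℤ F) ∈ M) {η : integralClosure ℤ F} {j : ℕ}
    (hη : η ^ p ^ j = 1) : Ideal.Quotient.mk M η = 1 := by
  have := Fact.mk hp
  have := Ideal.Quotient.nontrivial_iff.2 hM.ne_top
  have : CharP (integralClosure ℤ F ⧸ M) p := by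
    have := Ideal.Quotient.isDomain M
    exact ringChar.of_eq (CharP.ringChar_of_prime_eq_zero hp
      (by simpa using Ideal.Quotient.eq_zero_iff_mem.2 hpM))
  have := Ideal.Quotient.isDomain M
  have h1 : (Ideal.Quotient.mk M η - 1) ^ p ^ j = 0 := by
    rw [sub_pow_char_pow, ← map_pow, hη]; simp
  exact sub_eq_zero.1 (eq_zero_of_pow_eq_zero h1)

variable [CharZero F]

theorem not_isIntegral_inv_natCast {p : ℕ} (hp : p.Prime) : ¬ IsIntegral ℤ ((p : F)⁻¹) := by
  intro h
  have h' : IsIntegral ℤ ((p : ℚ)⁻¹) := by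
    rw [← isIntegral_algebraMap_iff (algebraMap ℚ F).injective]
    simpa using h
  obtain ⟨n, hn⟩ := IsIntegrallyClosed.isIntegral_iff.1 h'
  have hp0 : (p : ℚ) ≠ 0 := by exact_mod_cast hp.ne_zero
  have : (n : ℚ) * p = 1 := by
    rw [show (n : ℚ) = (p : ℚ)⁻¹ from hn, inv_mul_cancel₀ hp0]
  have h1 : n * p = 1 := by exact_mod_cast this
  have := Int.isUnit_iff.1 (IsUnit.of_mul_eq_one_right _ h1)
  have := hp.two_le
  lia

variable (F) in
theorem exists_isMaximal_natCast_mem {p : ℕ} (hp : p.Prime) :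
    ∃ M : Ideal (integralClosure ℤ F), M.IsMaximal ∧ (p : integralClosure ℤ F) ∈ M := by
  have : ¬ IsUnit (p : integralClosure ℤ F) := by
    rintro ⟨u, hu⟩
    apply not_isIntegral_inv_natCast (F := F) hp
    have h1 : (p : F) * ((u⁻¹ : _ˣ) : integralClosure ℤ F) = 1 := by
      have := congrArg (Subtype.val) (u.mul_inv)
      rw [hu] at this
      simpa using this
    rw [← eq_inv_of_mul_eq_one_right h1]
    exact (((u⁻¹ : _ˣ) : integralClosure ℤ F)).2
  obtain ⟨M, hM, hle⟩ := Ideal.exists_le_maximal _ (Ideal.span_singleton_ne_top this)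
  exact ⟨M, hM, hle (Ideal.mem_span_singleton_self _)⟩

/-- The arithmetic reason why prime powers give a single `{q}` instead of a component. Write `q = p
^ j` and reduce modulo a maximal ideal over `p`. If `N` is a larger power of `p`, then `(w - w⁻¹) /
(v - v⁻¹)` is, up to a unit, a sum of `k` terms congruent to `1` with `p ∣ k`, so it vanishes modulo
the ideal and cannot divide a unit. If `N` is not a prime power, `v - v⁻¹` is a unit, but its
divisor `w - w⁻¹` is not. -/
theorem eq_of_primitive_of_isIntegral {w v : Fˣ} {q N : ℕ} (hq : IsPrimePow q) (hN : 0 < N)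
    (hw : IsPrimitiveRoot w (2 * q)) (hv : IsPrimitiveRoot v (2 * N)) {k : ℕ} (hk : v ^ k = w)
    {y : F} (hy : IsIntegral ℤ y) (h : (v - (v : F)⁻¹ : F) = y * (w - (w : F)⁻¹)) : N = q := by
  obtain ⟨p, j, hp, hj, rfl⟩ := hq
  rw [← Nat.prime_iff] at hp
  obtain ⟨M, hM, hpM⟩ := exists_isMaximal_natCast_mem F hp
  have hMd := Ideal.Quotient.isDomain M
  have hp1 : 1 < p ^ j := Nat.one_lt_pow hj.ne' hp.one_lt
  have hv' := IsPrimitiveRoot.coe_units_iff.2 hv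
  have hw' := IsPrimitiveRoot.coe_units_iff.2 hw
  have hvi : IsIntegral ℤ (v : F) := hv'.isIntegral (by lia)
  have hwi : IsIntegral ℤ (w : F) := hw'.isIntegral (by lia)
  have hdvd : p ^ j ∣ N := by
    have h1 : w ^ (2 * N) = 1 := by
      rw [← hk, ← pow_mul, mul_comm, pow_mul, hv.pow_eq_one, one_pow]
    exact Nat.dvd_of_mul_dvd_mul_left two_pos ((hw.pow_eq_one_iff_dvd _).1 h1)
  have hN1 : 1 < N := lt_of_lt_of_le hp1 (Nat.le_of_dvd hN hdvd)
  have hv2 : IsPrimitiveRoot ((v : F) ^ 2) N := hv'.pow (by lia) rfl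
  have hw2 : IsPrimitiveRoot ((w : F) ^ 2) (p ^ j) := hw'.pow (by lia) rfl
  have hv0 := v.ne_zero
  have hw0 := w.ne_zero
  by_cases hNp : IsPrimePow N
  · -- `[k] = (v ^ k - v ^ (-k)) / (v - v⁻¹)` is a unit
    by_contra hne
    have hNp' : ∃ i, N = p ^ i := by
      obtain ⟨p', i, hp', hi, rfl⟩ := hNp
      rw [← Nat.prime_iff] at hp'
      have : p ∣ p' ^ i := (dvd_pow_self p hj.ne').trans hdvd
      rw [(Nat.prime_dvd_prime_iff_eq hp hp').1 (hp.dvd_of_dvd_pow this)]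
      exact ⟨i, rfl⟩
    obtain ⟨i, rfl⟩ := hNp'
    -- If `p` did not divide `k`, then `w = v ^ k` would have `p`-part as large as that of `v`,
    -- forcing `p ^ i ∣ p ^ j`.
    have hpk : p ∣ k := by
      by_contra hpk
      have hcop : (p ^ i).Coprime k := (Nat.Prime.coprime_iff_not_dvd hp).2 hpk |>.pow_left i
      have h1 : (v ^ 2) ^ (k * p ^ j) = 1 := by
        rw [← pow_mul, show 2 * (k * p ^ j) = k * (2 * p ^ j) by ring, pow_mul, hk, hw.pow_eq_one]
      have h2 : IsPrimitiveRoot (v ^ 2) (p ^ i) := hv.pow (by lia) rfl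
      have h3 := (h2.pow_eq_one_iff_dvd _).1 h1
      exact hne (Nat.dvd_antisymm (hcop.dvd_of_dvd_mul_left h3) hdvd)
    let η : integralClosure ℤ F := ⟨(v : F) ^ 2, hvi.pow 2⟩
    let Y : integralClosure ℤ F := ⟨y, hy⟩
    let V : integralClosure ℤ F := ⟨v, hvi⟩
    have hη : Ideal.Quotient.mk M η = 1 :=
      mk_eq_one_of_pow_prime_pow hp hM hpM (j := i) (Subtype.ext (by
        simpa [η] using hv2.pow_eq_one))
    have hsum : V * Y * ∑ i ∈ Finset.range k, η ^ i = V ^ k := by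
      apply Subtype.ext
      have hd : (v - (v : F)⁻¹ : F) ≠ 0 := sub_inv_ne_zero fun h2 => by
        have := (hv.pow_eq_one_iff_dvd _).1 h2
        have := Nat.le_of_dvd two_pos this
        lia
      have h1 := pow_sub_inv_pow v k
      have h2 := congrArg (· * (v : F) ^ k) h
      simp only [← hk, Units.val_pow_eq_pow_val] at h2
      rw [mul_assoc, h1] at h2
      apply mul_left_cancel₀ hd
      simp only [V, Y, η]
      push_cast
      rw [h2]
      ring
    have hpM' : Ideal.Quotient.mk M (p : integralClosure ℤ F) = 0 :=
      Ideal.Quotient.eq_zero_iff_mem.2 hpM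
    have h3 := congrArg (Ideal.Quotient.mk M) hsum
    obtain ⟨k', rfl⟩ := hpk
    rw [map_mul, map_sum] at h3
    simp only [map_pow, hη, one_pow, Finset.sum_const, Finset.card_range, nsmul_eq_mul, mul_one,
      Nat.cast_mul] at h3
    rw [map_natCast] at hpM'
    rw [hpM', zero_mul, mul_zero] at h3
    have hVM : Ideal.Quotient.mk M V = 0 := eq_zero_of_pow_eq_zero h3.symm
    have : η = V ^ 2 := rfl
    rw [this, map_pow, hVM] at hη
    simp at hη
  · exfalso
    have hu := isIntegral_inv_one_sub hv2 hN1 hNp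
    -- so `1 - w²` is a unit
    let η : integralClosure ℤ F := ⟨(w : F) ^ 2, hwi.pow 2⟩
    have hη : Ideal.Quotient.mk M η = 1 :=
      mk_eq_one_of_pow_prime_pow hp hM hpM (j := j) (Subtype.ext (by
        simpa [η] using hw2.pow_eq_one))
    have hwinv : IsIntegral ℤ ((w⁻¹ : Fˣ) : F) :=
      (IsPrimitiveRoot.coe_units_iff.2 hw.inv).isIntegral (by lia)
    let B : integralClosure ℤ F :=
      ⟨_, ((hvi.mul hy).mul hwinv).mul hu⟩
    have hB : (1 - η) * B = 1 := by
      apply Subtype.ext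
      have hne : (1 - (v : F) ^ 2) ≠ 0 := by
        intro h0
        have : (v : F) ^ 2 = 1 := (sub_eq_zero.1 h0).symm
        rw [this] at hv2
        have := hv2.unique IsPrimitiveRoot.one
        lia
      simp only [η, B]
      push_cast
      field_simp at h ⊢
      linear_combination h
    have := congrArg (Ideal.Quotient.mk M) hB
    rw [map_mul, map_sub, hη, map_one] at this
    simp at this

end Integral

/-! ### The components of the graph `Q_K` -/

section Components

set_option linter.unusedSectionVars false

variable {K : Type u} [Field K] [CharZero K]

theorem exists_primitive_units {n : ℕ} (hn : 0 < n) :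
    ∃ u : (AlgebraicClosure K)ˣ, IsPrimitiveRoot u (2 * n) := by
  have : NeZero (2 * n) := ⟨by lia⟩
  have : CharZero (AlgebraicClosure K) := charZero_of_injective_algebraMap
    (algebraMap K (AlgebraicClosure K)).injective
  obtain ⟨z, hz⟩ := HasEnoughRootsOfUnity.exists_primitiveRoot (AlgebraicClosure K) (2 * n)
  exact ⟨(hz.isUnit (by lia)).unit, by
    rw [← IsPrimitiveRoot.coe_units_iff]; simpa using hz⟩

theorem sq_ne_one_of_primitive {G : Type*} [CommGroup G] {u : G} {n : ℕ}
    (hu : IsPrimitiveRoot u (2 * n)) (hn : 1 < n) : u ^ 2 ≠ 1 := fun h => by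
  have := Nat.le_of_dvd two_pos ((hu.pow_eq_one_iff_dvd _).1 h)
  lia

theorem isOfFinOrder_of_primitive {G : Type*} [CommGroup G] {u : G} {n : ℕ}
    (hu : IsPrimitiveRoot u n) (hn : 0 < n) : IsOfFinOrder u :=
  isOfFinOrder_iff_pow_eq_one.2 ⟨n, hn, hu.pow_eq_one⟩

theorem exists_pow_eq_of_primitive {F : Type*} [Field F] {u v : Fˣ} {n : ℕ} (hn : 0 < n)
    (hu : IsPrimitiveRoot u n) (hv : v ^ n = 1) : ∃ i : ℕ, u ^ i = v := by
  have : NeZero n := ⟨hn.ne'⟩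
  obtain ⟨i, -, hi⟩ := (IsPrimitiveRoot.coe_units_iff.2 hu).eq_pow_of_pow_eq_one
    (ξ := (v : F)) (by simpa using congrArg Units.val hv)
  exact ⟨i, Units.ext (by exact_mod_cast hi)⟩

theorem mem_Q_of_primitive {n : ℕ} (hn : 1 < n) {u : (AlgebraicClosure K)ˣ}
    (hu : IsPrimitiveRoot u (2 * n)) (h : (u + (u : AlgebraicClosure K)⁻¹ : AlgebraicClosure K) ∈
      (algebraMap K (AlgebraicClosure K)).fieldRange) : n ∈ Q K :=
  ⟨hn, u, IsPrimitiveRoot.coe_units_iff.2 hu, h⟩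

theorem charZero_algebraicClosure : CharZero (AlgebraicClosure K) :=
  charZero_of_injective_algebraMap (algebraMap K (AlgebraicClosure K)).injective

attribute [local instance] charZero_algebraicClosure

theorem add_inv_mem_of_mem_Q {n : ℕ} (hn : n ∈ Q K) {u : (AlgebraicClosure K)ˣ}
    (hu : IsPrimitiveRoot u (2 * n)) : (u + (u : AlgebraicClosure K)⁻¹ : AlgebraicClosure K) ∈
      (algebraMap K (AlgebraicClosure K)).fieldRange := by
  obtain ⟨h1, z, hz, h⟩ := hn
  obtain ⟨v, rfl⟩ := hz.isUnit (by lia)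
  rw [IsPrimitiveRoot.coe_units_iff] at hz
  obtain ⟨i, rfl⟩ := exists_pow_eq_of_primitive (by lia) hz hu.pow_eq_one
  exact (mem_quadGroup.1 (pow_mem_quadGroup_self (isOfFinOrder_of_primitive hz (by lia)) h
    (sq_ne_one_of_primitive hz h1) i)).2.1

theorem mem_Q_of_dvd {n d : ℕ} (hn : n ∈ Q K) (hd : 1 < d) (hdn : d ∣ n) : d ∈ Q K := by
  have h1 := hn.1
  obtain ⟨u, hu⟩ := exists_primitive_units (K := K) (n := n) (by lia)
  obtain ⟨k, rfl⟩ := hdn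
  refine mem_Q_of_primitive hd (hu.pow (by lia) (show 2 * (d * k) = k * (2 * d) by ring)) ?_
  exact (mem_quadGroup.1 (pow_mem_quadGroup_self (isOfFinOrder_of_primitive hu (by lia))
    (add_inv_mem_of_mem_Q hn hu) (sq_ne_one_of_primitive hu h1) k)).2.1

variable (K) in
/-- The group of roots of unity in `K(ζ)` where `ζ` is a primitive `2n`-th root of unity,
`n ∈ Q_K`. -/
noncomputable def quadOf {n : ℕ} (hn : n ∈ Q K) {u : (AlgebraicClosure K)ˣ} (hu : IsPrimitiveRoot u (2 * n)) :
    Subgroup (AlgebraicClosure K)ˣ :=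
  quadGroup K (u - (u : AlgebraicClosure K)⁻¹ : AlgebraicClosure K)
    (sub_inv_ne_zero (sq_ne_one_of_primitive hu hn.1)) (sub_inv_sq_mem K (add_inv_mem_of_mem_Q hn hu))

theorem self_mem_quadOf {n : ℕ} (hn : n ∈ Q K) {u : (AlgebraicClosure K)ˣ}
    (hu : IsPrimitiveRoot u (2 * n)) : u ∈ quadOf K hn hu := by
  have := hn.1
  simpa [quadOf] using pow_mem_quadGroup_self (isOfFinOrder_of_primitive hu (by lia))
    (add_inv_mem_of_mem_Q hn hu) (sq_ne_one_of_primitive hu hn.1) 1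

/-- If a root of unity `z` has a nontrivial power in `quadGroup K δ`, then it is there itself. -/
theorem mem_quadGroup_of_pow_mem {F : Type*} [Field F] [Algebra K F] [NeZero (2 : F)] {δ : F}
    {h0 : δ ≠ 0} {h2 : δ ^ 2 ∈ (algebraMap K F).fieldRange} {z : Fˣ} (hz : IsOfFinOrder z)
    (h : (z + (z : F)⁻¹ : F) ∈ (algebraMap K F).fieldRange) {k : ℕ} (hk : (z ^ k) ^ 2 ≠ 1)
    (hm : z ^ k ∈ quadGroup K δ h0 h2) : z ∈ quadGroup K δ h0 h2 := by
  have hz2 : z ^ 2 ≠ 1 := fun h1 => hk (by rw [← pow_mul, mul_comm, pow_mul, h1, one_pow])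
  have h3 := mem_quadGroup.1 (pow_mem_quadGroup_self hz h hz2 k)
  have hm' := mem_quadGroup.1 hm
  refine mem_quadGroup.2 ⟨hz, h, ?_⟩
  have hne := sub_inv_ne_zero hk
  -- With `d = z ^ k - z ^ (-k) ≠ 0`, one has `(z - z⁻¹) δ = ((z - z⁻¹) d)(d δ) / d²`, and all three
  -- factors lie in `K`.
  have := mul_mem (mul_mem h3.2.2 hm'.2.2) (inv_mem (sub_inv_sq_mem K h3.2.1))
  convert this using 1
  generalize ((z ^ k : Fˣ) - ((z ^ k : Fˣ) : F)⁻¹ : F) = d at hne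
  generalize (z - (z : F)⁻¹ : F) = e
  field_simp

theorem reachable_of_mul {k : ℕ} : ∀ {n : ℕ} (hn : n ∈ Q K) (hnk : n * k ∈ Q K),
    (digraphQ K).toSimpleGraphInclusive.Reachable ⟨n, hn⟩ ⟨n * k, hnk⟩ := by
  induction k using induction_on_primes with
  | zero => intro n hn hnk; exact absurd hnk.1 (by simp)
  | one => intro n hn hnk; simp only [mul_one]; exact .refl _
  | prime_mul p k hp ih =>
    intro n hn hnk
    have h1 := hn.1
    have hp1 := hp.one_lt
    have hnp : n * p ∈ Q K := mem_Q_of_dvd hnk (by nlinarith) ⟨k, by ring⟩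
    have hnk' : n * p * k ∈ Q K := by rwa [mul_assoc]
    have hadj : (digraphQ K).toSimpleGraphInclusive.Adj ⟨n, hn⟩ ⟨n * p, hnp⟩ := by
      refine ⟨fun h => ?_, Or.inl ⟨Dvd.intro _ rfl, ?_⟩⟩
      · have := congrArg Subtype.val h
        simp only at this
        nlinarith
      · simpa [Nat.mul_div_cancel_left p (show 0 < n by lia)] using hp
    have h3 := hadj.reachable.trans (ih hnp hnk')
    simp only [mul_assoc] at h3
    exact h3

theorem reachable_of_dvd {n N : ℕ} (hn : n ∈ Q K) (hN : N ∈ Q K) (h : n ∣ N) :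
    (digraphQ K).toSimpleGraphInclusive.Reachable ⟨n, hn⟩ ⟨N, hN⟩ := by
  obtain ⟨k, rfl⟩ := h
  exact reachable_of_mul hn hN

variable (K) in
/-- The component of `n` in `Q_K`. -/
noncomputable def component {n : ℕ} (hn : n ∈ Q K) : Set ℕ :=
  Subtype.val '' ((digraphQ K).toSimpleGraphInclusive.connectedComponentMk ⟨n, hn⟩).supp

/-- The quadratic field does not change along an edge. Downwards one takes a power. Upwards, a power
of the new root of unity is already in the group and is not `±1`, since members of `Q_K` exceed `1`;
so the new one is there too. -/
theorem exists_primitive_of_reachable {n : ℕ} (hn : n ∈ Q K) {u : (AlgebraicClosure K)ˣ}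
    (hu : IsPrimitiveRoot u (2 * n)) {m : Q K}
    (h : (digraphQ K).toSimpleGraphInclusive.Reachable ⟨n, hn⟩ m) :
    ∃ v ∈ quadOf K hn hu, IsPrimitiveRoot v (2 * (m : ℕ)) := by
  rw [SimpleGraph.reachable_iff_reflTransGen] at h
  induction h with
  | refl => exact ⟨u, self_mem_quadOf hn hu, hu⟩
  | @tail a b _ hab ih =>
    obtain ⟨v, hv, hva⟩ := ih
    have ha1 := a.2.1
    have hb1 := b.2.1
    rcases hab.2 with ⟨h, -⟩ | ⟨h, -⟩
    · obtain ⟨z, hz⟩ := exists_primitive_units (K := K) (n := b) (by lia)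
      obtain ⟨k, hk⟩ := h
      have hzk : IsPrimitiveRoot (z ^ k) (2 * a) := hz.pow (by lia) (by rw [hk]; ring)
      refine ⟨z, mem_quadGroup_of_pow_mem (isOfFinOrder_of_primitive hz (by lia))
        (add_inv_mem_of_mem_Q b.2 hz) (k := k) (sq_ne_one_of_primitive hzk ha1) ?_, hz⟩
      obtain ⟨i, hi⟩ := exists_pow_eq_of_primitive (by lia) hva hzk.pow_eq_one
      rw [← hi]
      exact Subgroup.pow_mem _ hv i
    · obtain ⟨k, hk⟩ := h
      exact ⟨v ^ k, Subgroup.pow_mem _ hv k, hva.pow (by lia) (by rw [hk]; ring)⟩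

theorem mem_component {n : ℕ} (hn : n ∈ Q K) {u : (AlgebraicClosure K)ˣ}
    (hu : IsPrimitiveRoot u (2 * n)) {m : ℕ} :
    m ∈ component K hn ↔ 1 < m ∧ ∃ v ∈ quadOf K hn hu, IsPrimitiveRoot v (2 * m) := by
  have hn1 := hn.1
  constructor
  · rintro ⟨m, hm, rfl⟩
    rw [SimpleGraph.ConnectedComponent.mem_supp_iff, SimpleGraph.ConnectedComponent.eq] at hm
    exact ⟨m.2.1, exists_primitive_of_reachable hn hu hm.symm⟩
  · rintro ⟨hm1, v, hv, hvm⟩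
    -- The group also contains a primitive root of order `lcm (2n) (2m) = 2 lcm n m`. So `lcm n m`
    -- is in `Q_K` and joins `n` to `m`.
    obtain ⟨w, hw, hwp, -, -⟩ := exists_primitive_lcm (self_mem_quadOf hn hu) hv hu hvm
      (by lia) (by lia)
    rw [Nat.lcm_mul_left] at hwp
    have hlt : 1 < n.lcm m := lt_of_lt_of_le hn1
      (Nat.le_of_dvd (Nat.lcm_pos (by lia) (by lia)) (Nat.dvd_lcm_left _ _))
    have hN : n.lcm m ∈ Q K := mem_Q_of_primitive hlt hwp (mem_quadGroup.1 hw).2.1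
    have hm : m ∈ Q K := mem_Q_of_dvd hN hm1 (Nat.dvd_lcm_right _ _)
    refine ⟨⟨m, hm⟩, ?_, rfl⟩
    rw [SimpleGraph.ConnectedComponent.mem_supp_iff, SimpleGraph.ConnectedComponent.eq]
    exact (reachable_of_dvd hm hN (Nat.dvd_lcm_right _ _)).trans
      (reachable_of_dvd hn hN (Nat.dvd_lcm_left _ _)).symm

/-- A group of roots of unity containing a primitive `2n`-th one is the union of the cyclic groups
of order `2N`, `n ∣ N`, it contains. -/
theorem exists_primitive_two_mul {F : Type*} [Field F] {G : Subgroup Fˣ} {u v : Fˣ} {n : ℕ}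
    (hu : u ∈ G) (hv : v ∈ G) (hn : 0 < n) (hun : IsPrimitiveRoot u (2 * n))
    (hvf : IsOfFinOrder v) :
    ∃ N, n ∣ N ∧ 0 < N ∧ ∃ w ∈ G, IsPrimitiveRoot w (2 * N) ∧
      (∃ i : ℕ, w ^ i = u) ∧ ∃ i : ℕ, w ^ i = v := by
  obtain ⟨w, hw, hwp, h1, h2⟩ := exists_primitive_lcm hu hv hun (IsPrimitiveRoot.orderOf v)
    (by lia) hvf.orderOf_pos.ne'
  obtain ⟨k, hk⟩ := Nat.dvd_lcm_left (2 * n) (orderOf v)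
  have hpos := Nat.lcm_pos (show 0 < 2 * n by lia) hvf.orderOf_pos
  rw [hk, mul_assoc] at hwp hpos
  exact ⟨n * k, Dvd.intro _ rfl, by lia, w, hw, hwp, h1, h2⟩

theorem muOf_component {n : ℕ} (hn : n ∈ Q K) {u : (AlgebraicClosure K)ˣ}
    (hu : IsPrimitiveRoot u (2 * n)) : muOf K (component K hn) = quadOf K hn hu := by
  have hn1 := hn.1
  apply le_antisymm
  · rw [muOf, Subgroup.closure_le]
    rintro g ⟨m, hm, hg⟩
    obtain ⟨hm1, v, hv, hvm⟩ := (mem_component hn hu).1 hm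
    obtain ⟨i, rfl⟩ := exists_pow_eq_of_primitive (by lia) hvm hg.pow_eq_one
    exact Subgroup.pow_mem _ hv i
  · intro g hg
    obtain ⟨N, hnN, hN, w, hw, hwN, -, i, rfl⟩ := exists_primitive_two_mul (self_mem_quadOf hn hu)
      hg (by lia) hu (mem_quadGroup.1 hg).1
    refine Subgroup.pow_mem (muOf K _) (Subgroup.subset_closure ⟨N, ?_, hwN⟩) i
    exact (mem_component hn hu).2 ⟨lt_of_lt_of_le hn1 (Nat.le_of_dvd hN hnN), w, hw, hwN⟩

theorem muOf_singleton {q : ℕ} (hq : 0 < q) {u : (AlgebraicClosure K)ˣ}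
    (hu : IsPrimitiveRoot u (2 * q)) : muOf K {q} = Subgroup.zpowers u := by
  apply le_antisymm
  · rw [muOf, Subgroup.closure_le]
    rintro g ⟨m, rfl, hg⟩
    obtain ⟨i, rfl⟩ := exists_pow_eq_of_primitive (by lia) hu hg.pow_eq_one
    exact Subgroup.npow_mem_zpowers u i
  · rw [Subgroup.zpowers_le]
    exact Subgroup.subset_closure ⟨q, rfl, hu⟩

theorem dvd_of_primitive_mem_zpowers {G : Type*} [CommGroup G] {u v : G} {n m : ℕ}
    (hu : IsPrimitiveRoot u (2 * n)) (hv : IsPrimitiveRoot v (2 * m))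
    (h : v ∈ Subgroup.zpowers u) : m ∣ n := by
  obtain ⟨i, rfl⟩ := h
  refine Nat.dvd_of_mul_dvd_mul_left two_pos ((hv.pow_eq_one_iff_dvd _).1 ?_)
  simp only [← zpow_natCast]
  rw [← zpow_mul, mul_comm, zpow_mul, zpow_natCast, hu.pow_eq_one, one_zpow]

theorem mem_setR_iff {C : Set ℕ} :
    C ∈ setR K ↔ ∃ (n : ℕ) (hn : n ∈ Q K), ¬ IsPrimePow n ∧ C = component K hn := by
  constructor
  · rintro ⟨⟨c, rfl⟩, -, ⟨n, hn, rfl⟩, hp⟩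
    refine ⟨n, n.2, hp, ?_⟩
    rw [SimpleGraph.ConnectedComponent.mem_supp_iff] at hn
    rw [← hn]; rfl
  · rintro ⟨n, hn, hp, rfl⟩
    exact ⟨⟨_, rfl⟩, n, ⟨⟨n, hn⟩, rfl, rfl⟩, hp⟩

theorem not_mem_muOf_singleton {q n : ℕ} (hq : IsPrimePow q) (hn1 : 1 < n) (hn : ¬ IsPrimePow n)
    {u : (AlgebraicClosure K)ˣ} (hu : IsPrimitiveRoot u (2 * n)) : u ∉ muOf K {q} := by
  intro h
  obtain ⟨v, hv⟩ := exists_primitive_units (K := K) hq.pos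
  rw [muOf_singleton hq.pos hv] at h
  exact hn (hq.dvd (dvd_of_primitive_mem_zpowers hv hu h) (by lia))

/-- A prime power `q` is read off from the order `2q` of its cyclic group, a component from its
group by `mem_component`. The two kinds differ because only components in `ℛ_K` yield a primitive
`2n`-th root of unity with `n` not a prime power. -/
theorem muOf_injOn : Set.InjOn (muOf K) (setP K ∪ setR K) := by
  have key : ∀ q ∈ Q K, IsPrimePow q → ∀ C ∈ setR K, muOf K {q} ≠ muOf K C := by
    intro q _ hq C hC h
    obtain ⟨n, hn, hp, rfl⟩ := mem_setR_iff.1 hC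
    have hn1 := hn.1
    obtain ⟨u, hu⟩ := exists_primitive_units (K := K) (n := n) (by lia)
    apply not_mem_muOf_singleton hq hn1 hp hu
    rw [h, muOf_component hn hu]
    exact self_mem_quadOf hn hu
  rintro C (⟨q, hq, hqp, rfl⟩ | hC) C' (⟨q', hq', hqp', rfl⟩ | hC') h
  · obtain ⟨u, hu⟩ := exists_primitive_units (K := K) hqp.pos
    obtain ⟨u', hu'⟩ := exists_primitive_units (K := K) hqp'.pos
    rw [muOf_singleton hqp.pos hu, muOf_singleton hqp'.pos hu'] at h
    rw [Nat.dvd_antisymm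
      (dvd_of_primitive_mem_zpowers hu' hu (h ▸ Subgroup.mem_zpowers u))
      (dvd_of_primitive_mem_zpowers hu hu' (h ▸ Subgroup.mem_zpowers u'))]
  · exact absurd h (key q hq hqp C' hC')
  · exact absurd h.symm (key q' hq' hqp' C hC)
  · obtain ⟨n, hn, -, rfl⟩ := mem_setR_iff.1 hC
    obtain ⟨n', hn', -, rfl⟩ := mem_setR_iff.1 hC'
    have h1 := hn.1
    have h2 := hn'.1
    obtain ⟨u, hu⟩ := exists_primitive_units (K := K) (n := n) (by lia)
    obtain ⟨u', hu'⟩ := exists_primitive_units (K := K) (n := n') (by lia)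
    rw [muOf_component hn hu, muOf_component hn' hu'] at h
    ext m
    rw [mem_component hn hu, mem_component hn' hu', h]

end Components

/-! ### Complex conjugation and Kronecker's theorem -/

section Conj

set_option linter.unusedSectionVars false

variable {K : Type u} [Field K]

theorem exists_extension (φ : K →+* ℝ) :
    ∃ ι : AlgebraicClosure K →+* ℂ, ∀ x : K, ι (algebraMap K (AlgebraicClosure K) x) = φ x := by
  let _ : Algebra K ℂ := ((algebraMap ℝ ℂ).comp φ).toAlgebra
  let ι : AlgebraicClosure K →ₐ[K] ℂ := IsAlgClosed.lift
  exact ⟨ι, fun x => ι.commutes x⟩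

theorem norm_map_eq_one {F : Type*} [Field F] (ι : F →+* ℂ) {z : Fˣ} (hz : IsOfFinOrder z) :
    ‖ι z‖ = 1 := by
  obtain ⟨n, hn, h⟩ := isOfFinOrder_iff_pow_eq_one.1 hz
  have : (ι z) ^ n = 1 := by
    rw [← map_pow, ← Units.val_pow_eq_pow_val, h]; simp
  exact Complex.norm_eq_one_of_pow_eq_one this hn.ne'

/-- As `φ` is real, complex conjugation is `K`-linear, and it restricts to the algebraic closure,
which is normal over `K`. On numbers of absolute value one it is inversion. -/
theorem exists_conj_of_embedding (φ : K →+* ℝ) :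
    ∃ c : AlgebraicClosure K →ₐ[K] AlgebraicClosure K,
      ∀ z : (AlgebraicClosure K)ˣ, IsOfFinOrder z → c z = (z : AlgebraicClosure K)⁻¹ := by
  let _ : Algebra K ℂ := ((algebraMap ℝ ℂ).comp φ).toAlgebra
  let ι : AlgebraicClosure K →ₐ[K] ℂ := IsAlgClosed.lift
  let _ : Algebra (AlgebraicClosure K) ℂ := ι.toRingHom.toAlgebra
  have : IsScalarTower K (AlgebraicClosure K) ℂ := IsScalarTower.of_algebraMap_eq
    fun x => (ι.commutes x).symm
  let s : ℂ →ₐ[K] ℂ := { starRingEnd ℂ with commutes' := fun x => Complex.conj_ofReal (φ x) }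
  refine ⟨s.restrictNormal (AlgebraicClosure K), fun z hz => ?_⟩
  apply (algebraMap (AlgebraicClosure K) ℂ).injective
  rw [AlgHom.restrictNormal_commutes, map_inv₀,
    Complex.inv_eq_conj (norm_map_eq_one _ hz)]
  rfl

variable [CharZero K] [Algebra.IsAlgebraic ℚ K] [NumberField.IsTotallyReal K]

variable (K) in
theorem nonempty_real_embedding : Nonempty (K →+* ℝ) := by
  let ψ : K →ₐ[ℚ] ℂ := IsAlgClosed.lift
  exact ⟨(NumberField.IsTotallyReal.complexEmbedding_isReal (ψ : K →+* ℂ)).embedding⟩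

variable (K) in
/-- A `K`-endomorphism of the algebraic closure which inverts all roots of unity. -/
noncomputable def conj : AlgebraicClosure K →ₐ[K] AlgebraicClosure K :=
  (exists_conj_of_embedding (nonempty_real_embedding K).some).choose

theorem conj_of_isOfFinOrder {z : (AlgebraicClosure K)ˣ} (hz : IsOfFinOrder z) :
    conj K z = (z : AlgebraicClosure K)⁻¹ :=
  (exists_conj_of_embedding (nonempty_real_embedding K).some).choose_spec z hz

/-- `w` is a root of `X² - r X + 1`, of discriminant `r² - 4 ≤ 0`: either its two roots are complex
conjugates with product one, or it has a double root `±1`. -/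
theorem norm_eq_one_of_add_inv {w : ℂ} (hw : w ≠ 0) {r : ℝ} (h : w + w⁻¹ = r) (hr : |r| ≤ 2) :
    ‖w‖ = 1 := by
  have h1 : w ^ 2 + 1 = r * w := by
    field_simp at h
    linear_combination h
  have hre := congrArg Complex.re h1
  have him := congrArg Complex.im h1
  simp [sq] at hre him
  have h2 : w.re = r / 2 := by
    by_cases hy : w.im = 0
    · rw [hy] at hre
      have := abs_le.1 hr
      have h4 : (w.re - r / 2) ^ 2 ≤ 0 := by nlinarith
      have := pow_eq_zero_iff two_ne_zero |>.1 (le_antisymm h4 (sq_nonneg _))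
      linarith
    · have : w.im * (2 * w.re - r) = 0 := by linear_combination him
      have := (mul_eq_zero.1 this).resolve_left hy
      linarith
  rw [Complex.norm_def, Complex.normSq_apply, Real.sqrt_eq_one]
  rw [show r = 2 * w.re by linarith] at hre
  linarith

theorem isIntegral_of_add_inv {z : (AlgebraicClosure K)ˣ} {a : 𝓞 K}
    (h : (z + (z : AlgebraicClosure K)⁻¹ : AlgebraicClosure K) =
      algebraMap K (AlgebraicClosure K) a) : IsIntegral ℤ (z : AlgebraicClosure K) := by
  have h1 : IsIntegral (𝓞 K) (z : AlgebraicClosure K) := by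
    refine ⟨Polynomial.X ^ 2 - Polynomial.C a * Polynomial.X + 1, by monicity!, ?_⟩
    have h2 : algebraMap (𝓞 K) (AlgebraicClosure K) a =
      algebraMap K (AlgebraicClosure K) a := IsScalarTower.algebraMap_apply (𝓞 K) K _ a
    have h0 := z.ne_zero
    simp only [Polynomial.eval₂_add, Polynomial.eval₂_sub, Polynomial.eval₂_pow,
      Polynomial.eval₂_X, Polynomial.eval₂_mul, Polynomial.eval₂_C, Polynomial.eval₂_one, h2, ← h]
    field_simp
    ring
  exact isIntegral_trans _ h1

/-- Kronecker's theorem in `ℚ(z)`: each complex embedding extends to the algebraic closure, where it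
restricts to a real embedding of `K`, and `|σ a| ≤ 2` puts the image of `z` on the unit circle. -/
theorem isOfFinOrder_of_add_inv {z : (AlgebraicClosure K)ˣ} {a : 𝓞 K}
    (h : (z + (z : AlgebraicClosure K)⁻¹ : AlgebraicClosure K) =
      algebraMap K (AlgebraicClosure K) a) (ha : ∀ σ : K →+* ℝ, |σ a| ≤ 2) :
    IsOfFinOrder z := by
  have := charZero_algebraicClosure (K := K)
  have hz := isIntegral_of_add_inv h
  have : Algebra.IsAlgebraic ℚ (AlgebraicClosure K) := Algebra.IsAlgebraic.trans ℚ K _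
  let E := IntermediateField.adjoin ℚ {(z : AlgebraicClosure K)}
  have hfd : FiniteDimensional ℚ E :=
    IntermediateField.adjoin.finiteDimensional hz.tower_top
  have hnf : NumberField E := ⟨⟩
  let x : E := IntermediateField.AdjoinSimple.gen ℚ (z : AlgebraicClosure K)
  have hx : (x : AlgebraicClosure K) = z := rfl
  have hxi : IsIntegral ℤ x := (isIntegral_algebraMap_iff
    (algebraMap E (AlgebraicClosure K)).injective).1 hz
  obtain ⟨n, hn, hxn⟩ := NumberField.Embeddings.pow_eq_one_of_norm_eq_one E ℂ hxi (by
    intro φ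
    let ι := NumberField.ComplexEmbedding.lift (AlgebraicClosure K) φ
    have hι : φ x = ι z := by
      rw [← hx]
      exact (NumberField.ComplexEmbedding.lift_algebraMap_apply (AlgebraicClosure K) φ x).symm
    have hreal := NumberField.IsTotallyReal.complexEmbedding_isReal
      (ι.comp (algebraMap K (AlgebraicClosure K)))
    have hr : ι z + (ι z)⁻¹ = (hreal.embedding a : ℝ) := by
      rw [NumberField.ComplexEmbedding.IsReal.coe_embedding_apply, ← map_inv₀, ← map_add, h]
      rfl
    rw [hι]
    exact norm_eq_one_of_add_inv (by simp) hr (ha _))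
  refine isOfFinOrder_iff_pow_eq_one.2 ⟨n, hn, Units.ext ?_⟩
  have := congrArg (algebraMap E (AlgebraicClosure K)) hxn
  simpa [hx] using this

end Conj

/-! ### Realizing a root lattice of rank two in the algebraic closure -/

section Realization

set_option linter.unusedSectionVars false

variable {K : Type u} [Field K]

namespace RootLattice

variable (L : RootLattice K)

theorem abs_form_le {α β : L.carrier} (hα : α ∈ L.roots) (hβ : β ∈ L.roots) (σ : K →+* ℝ) :
    |σ (L.form α β)| ≤ 2 := by
  have h0 : ∀ x, 0 ≤ σ (L.form x x) := fun x => by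
    by_cases hx : x = 0
    · simp [hx]
    · exact (L.totally_pos σ x hx).le
  have h1 := h0 (α + β)
  have h2 := h0 (α - β)
  have hα' : L.form α α = 2 := hα
  have hβ' : L.form β β = 2 := hβ
  have h2' : ((2 : 𝓞 K) : K) = 2 := rfl
  have hσ : σ 2 = 2 := map_ofNat σ 2
  simp [hα', hβ', L.symm β α, h2', hσ] at h1 h2
  rw [abs_le]
  constructor <;> linarith

theorem abs_form_lt {α β : L.carrier} (hα : α ∈ L.roots) (hβ : β ∈ L.roots) (h : β ≠ α)
    (h' : β ≠ -α) (σ : K →+* ℝ) : |σ (L.form α β)| < 2 := by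
  have h1 := L.totally_pos σ (α + β) (fun h0 => h' (eq_neg_of_add_eq_zero_right h0))
  have h2 := L.totally_pos σ (α - β) (fun h0 => h (sub_eq_zero.1 h0).symm)
  have hα' : L.form α α = 2 := hα
  have hβ' : L.form β β = 2 := hβ
  have h2' : ((2 : 𝓞 K) : K) = 2 := rfl
  have hσ : σ 2 = 2 := map_ofNat σ 2
  simp [hα', hβ', L.symm β α, h2', hσ] at h1 h2
  rw [abs_lt]
  constructor <;> linarith

theorem exists_root_pair (hr : L.rank = 2) :
    ∃ α ∈ L.roots, ∃ β ∈ L.roots, β ≠ α ∧ β ≠ -α := by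
  have hspan : Submodule.span (𝓞 K) L.roots = ⊤ := L.span_roots
  have hne : L.roots.Nonempty := by
    by_contra h
    rw [Set.not_nonempty_iff_eq_empty] at h
    rw [h, Submodule.span_empty] at hspan
    exact bot_ne_top hspan
  obtain ⟨α, hα⟩ := hne
  refine ⟨α, hα, ?_⟩
  by_contra! h
  have hle : (⊤ : Submodule (𝓞 K) L.carrier) ≤ Submodule.span (𝓞 K) {α} := by
    rw [← hspan, Submodule.span_le]
    intro β hβ
    have := Submodule.mem_span_singleton_self (R := 𝓞 K) α
    by_cases hb : β = α
    · rwa [hb]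
    · rw [h β hβ hb]; exact neg_mem this
  have h1 := finrank_span_le_card (R := 𝓞 K) ({α} : Set L.carrier)
  rw [top_le_iff.1 hle, finrank_top] at h1
  have : Module.finrank (𝓞 K) L.carrier = 2 := hr
  simp at h1
  lia

variable [CharZero K] [Algebra.IsAlgebraic ℚ K] [NumberField.IsTotallyReal K]

/-- This is the Gram determinant of `α` and `β`. -/
theorem four_sub_sq_ne_zero {α β : L.carrier} (hα : α ∈ L.roots) (hβ : β ∈ L.roots) (h : β ≠ α)
    (h' : β ≠ -α) : 4 - L.form α β ^ 2 ≠ 0 := by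
  intro h0
  obtain ⟨σ⟩ := nonempty_real_embedding K
  have h1 := abs_lt.1 (L.abs_form_lt hα hβ h h' σ)
  have h2 := congrArg (fun r : 𝓞 K => σ (r : K)) h0
  have h4 : ((4 : 𝓞 K) : K) = 4 := rfl
  have h4' : σ 4 = 4 := map_ofNat σ 4
  simp [h4, h4'] at h2
  nlinarith

theorem linearIndependent_of_roots {α β : L.carrier} (hα : α ∈ L.roots) (hβ : β ∈ L.roots)
    (h : β ≠ α) (h' : β ≠ -α) {p q : 𝓞 K} (hpq : p • α + q • β = 0) : p = 0 ∧ q = 0 := by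
  have hne := L.four_sub_sq_ne_zero hα hβ h h'
  have hα' : L.form α α = 2 := hα
  have hβ' : L.form β β = 2 := hβ
  have h1 := congrArg (L.form α) hpq
  have h2 := congrArg (L.form β) hpq
  simp [hα', hβ', L.symm β α] at h1 h2
  constructor
  · exact (mul_eq_zero.1 (show p * (4 - L.form α β ^ 2) = 0 by
      linear_combination 2 * h1 - L.form α β * h2)).resolve_right hne
  · exact (mul_eq_zero.1 (show q * (4 - L.form α β ^ 2) = 0 by
      linear_combination 2 * h2 - L.form α β * h1)).resolve_right hne

theorem exists_smul_eq (hr : L.rank = 2) {α β : L.carrier} (hα : α ∈ L.roots) (hβ : β ∈ L.roots)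
    (h : β ≠ α) (h' : β ≠ -α) (x : L.carrier) :
    ∃ r p q : 𝓞 K, r ≠ 0 ∧ r • x = p • α + q • β := by
  have hn : ¬ LinearIndependent (𝓞 K) ![α, β, x] := fun hli => by
    have := hli.fintype_card_le_finrank
    have hr' : Module.finrank (𝓞 K) L.carrier = 2 := hr
    simp [hr'] at this
  obtain ⟨g, hg, i, hi⟩ := Fintype.not_linearIndependent_iff.1 hn
  simp [Fin.sum_univ_three] at hg
  refine ⟨g 2, -g 0, -g 1, fun h2 => ?_, ?_⟩
  · rw [h2, zero_smul, add_zero] at hg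
    obtain ⟨h0, h1⟩ := L.linearIndependent_of_roots hα hβ h h' hg
    fin_cases i <;> simp_all
  · rw [neg_smul, neg_smul]
    rw [← sub_eq_zero, ← hg]
    abel

/-- A realization of a root lattice inside the algebraic closure of `K`, such that the form is the
trace form `x · y = x ȳ + x̄ y`. -/
structure Realization where
  toFun : L.carrier →ₗ[𝓞 K] AlgebraicClosure K
  form_eq : ∀ x y, algebraMap K (AlgebraicClosure K) (L.form x y) =
    toFun x * conj K (toFun y) + conj K (toFun x) * toFun y
  base : L.carrier
  map_base : toFun base = 1

variable {L}

theorem algebraMap_integers_apply (a : 𝓞 K) : algebraMap (𝓞 K) (AlgebraicClosure K) a =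
    algebraMap K (AlgebraicClosure K) a := IsScalarTower.algebraMap_apply (𝓞 K) K _ a

theorem map_integers_smul {M : Type*} [AddCommGroup M] [Module (𝓞 K) M]
    (f : M →ₗ[𝓞 K] AlgebraicClosure K) (a : 𝓞 K) (x : M) :
    f (a • x) = algebraMap K (AlgebraicClosure K) a * f x := by
  rw [map_smul, ← algebraMap_integers_apply]
  exact Algebra.smul_def a (f x)

theorem exists_realization (hr : L.rank = 2) {α β : L.carrier} (hα : α ∈ L.roots)
    (hβ : β ∈ L.roots) (h : β ≠ α) (h' : β ≠ -α) {ζ : (AlgebraicClosure K)ˣ}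
    (hζ : (ζ + (ζ : AlgebraicClosure K)⁻¹ : AlgebraicClosure K) =
      algebraMap K (AlgebraicClosure K) (L.form α β)) :
    ∃ R : L.Realization, R.base = α ∧ R.toFun β = ζ := by
  have hfin := isOfFinOrder_of_add_inv hζ (L.abs_form_le hα hβ)
  have hα' : L.form α α = 2 := hα
  have hβ' : L.form β β = 2 := hβ
  have hz0 := ζ.ne_zero
  have h2 : ((2 : 𝓞 K) : K) = 2 := rfl
  have hζ2 : ζ ^ 2 ≠ 1 := by
    intro h2
    apply L.four_sub_sq_ne_zero hα hβ h h'
    have hz2 : (ζ : AlgebraicClosure K) ^ 2 = 1 := by simpa using congrArg Units.val h2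
    apply NumberField.RingOfIntegers.coe_injective
    apply (algebraMap K (AlgebraicClosure K)).injective
    have h4 : ((4 : 𝓞 K) : K) = 4 := rfl
    simp only [map_sub, map_pow, h4, ← hζ, map_zero, map_ofNat]
    field_simp
    linear_combination (1 - (ζ : AlgebraicClosure K) ^ 2) * hz2
  have hd := sub_inv_ne_zero hζ2
  set d : AlgebraicClosure K := ζ - (ζ : AlgebraicClosure K)⁻¹ with hd_def
  let f : L.carrier → L.carrier →ₗ[𝓞 K] AlgebraicClosure K := fun γ =>
    (Algebra.linearMap (𝓞 K) (AlgebraicClosure K)).comp (L.form γ)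
  have hf : ∀ γ x, f γ x = algebraMap K (AlgebraicClosure K) (L.form γ x) := fun γ x =>
    algebraMap_integers_apply _
  -- If `x` is to map to `X`, then `α·x = X + X̄` and `β·x = ζ⁻¹ X + ζ X̄`; eliminating `X̄` gives
  -- `(ζ - ζ⁻¹) X = ζ (α·x) - β·x`.
  let ψ : L.carrier →ₗ[𝓞 K] AlgebraicClosure K := (ζ * d⁻¹ : AlgebraicClosure K) • f α - d⁻¹ • f β
  have hψ : ∀ x, ψ x = ζ * d⁻¹ * f α x - d⁻¹ * f β x := fun x => rfl
  have hψα : ψ α = 1 := by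
    rw [hψ, hf, hf, hα', L.symm β α, ← hζ, h2, map_ofNat]
    field_simp
    rw [hd_def]; field_simp; ring
  have hψβ : ψ β = ζ := by
    rw [hψ, hf, hf, hβ', ← hζ, h2, map_ofNat]
    field_simp
    rw [hd_def]; field_simp; ring
  have hc : conj K ζ = (ζ : AlgebraicClosure K)⁻¹ := conj_of_isOfFinOrder hfin
  refine ⟨⟨ψ, fun x y => ?_, α, hψα⟩, rfl, hψβ⟩
  -- `α` and `β` need not generate `L`, only a submodule of full rank, so the identity is verified
  -- on multiples `r • x` and `r' • y`.
  obtain ⟨r, p, q, hr0, hx⟩ := L.exists_smul_eq hr hα hβ h h' x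
  obtain ⟨r', p', q', hr0', hy⟩ := L.exists_smul_eq hr hα hβ h h' y
  have hne : ∀ {r : 𝓞 K}, r ≠ 0 → algebraMap K (AlgebraicClosure K) r ≠ 0 := fun hr => by
    simpa using hr
  have hx1 := congrArg ψ hx
  have hy1 := congrArg ψ hy
  simp only [map_integers_smul, map_add, hψα, hψβ] at hx1 hy1
  have hx2 := congrArg (conj K) hx1
  have hy2 := congrArg (conj K) hy1
  simp only [map_mul, map_add, AlgHom.commutes, hc, map_one] at hx2 hy2
  have hform : r * r' * L.form x y = 2 * p * p' + L.form α β * (p * q' + q * p') + 2 * q * q' := by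
    have : L.form (r • x) (r' • y) = r * r' * L.form x y := by simp; ring
    rw [← this, hx, hy]
    simp [hα', hβ', L.symm β α]; ring
  have hform' := congrArg (fun r : 𝓞 K => algebraMap K (AlgebraicClosure K) r) hform
  simp only [map_mul, map_add, h2, map_ofNat, ← hζ] at hform'
  apply mul_left_cancel₀ (mul_ne_zero (hne hr0) (hne hr0'))
  rw [hform']
  have e1 : algebraMap K (AlgebraicClosure K) r * algebraMap K (AlgebraicClosure K) r' *
      (ψ x * conj K (ψ y) + conj K (ψ x) * ψ y) =
      (algebraMap K (AlgebraicClosure K) r * ψ x) *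
        (algebraMap K (AlgebraicClosure K) r' * conj K (ψ y)) +
      (algebraMap K (AlgebraicClosure K) r * conj K (ψ x)) *
        (algebraMap K (AlgebraicClosure K) r' * ψ y) := by ring
  rw [e1, hx1, hx2, hy1, hy2]
  field_simp
  ring

theorem exists_units_add_inv (a : AlgebraicClosure K) :
    ∃ ζ : (AlgebraicClosure K)ˣ, (ζ + (ζ : AlgebraicClosure K)⁻¹ : AlgebraicClosure K) = a := by
  obtain ⟨z, hz⟩ := IsAlgClosed.exists_eval₂_eq_zero (RingHom.id (AlgebraicClosure K))
    (Polynomial.X ^ 2 - Polynomial.C a * Polynomial.X + 1) (by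
      have : (Polynomial.X ^ 2 - Polynomial.C a * Polynomial.X + 1).degree = 2 := by
        compute_degree!
      rw [this]; decide)
  simp [Polynomial.eval₂_add] at hz
  have h0 : z ≠ 0 := by rintro rfl; simp at hz
  refine ⟨Units.mk0 z h0, ?_⟩
  simp only [Units.val_mk0]
  field_simp
  linear_combination hz

namespace Realization

variable (R : L.Realization)

theorem injective : Function.Injective R.toFun := by
  rw [injective_iff_map_eq_zero]
  intro x hx
  by_contra h0
  obtain ⟨σ⟩ := nonempty_real_embedding K
  have h1 := R.form_eq x x
  rw [hx] at h1
  simp at h1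
  have := L.totally_pos σ x h0
  simp [h1] at this

/-- Norm two means `X X̄ = 1` for the image `X`. Then `X + X⁻¹` is the inner product with the base
root, so it is bounded by two in all embeddings and Kronecker's theorem applies. -/
theorem mem_roots_iff {x : L.carrier} :
    x ∈ L.roots ↔ ∃ u : (AlgebraicClosure K)ˣ, IsOfFinOrder u ∧ R.toFun x = u := by
  have := charZero_algebraicClosure (K := K)
  have h2 : ((2 : 𝓞 K) : K) = 2 := rfl
  have hbase : R.base ∈ L.roots := by
    show L.form _ _ = 2
    apply NumberField.RingOfIntegers.coe_injective
    apply (algebraMap K (AlgebraicClosure K)).injective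
    rw [R.form_eq, R.map_base]
    rw [show (algebraMap (𝓞 K) K) 2 = 2 from h2, map_ofNat]
    simp
    norm_num
  constructor
  · intro hx
    have hx' : L.form x x = 2 := hx
    have h1 := R.form_eq x x
    rw [hx', h2, map_ofNat] at h1
    have hN : R.toFun x * conj K (R.toFun x) = 1 := by linear_combination (-1 / 2) * h1
    refine ⟨Units.mk _ _ hN (by rw [mul_comm, hN]), ?_, rfl⟩
    refine isOfFinOrder_of_add_inv (a := L.form x R.base) ?_ (L.abs_form_le hx hbase)
    rw [R.form_eq, R.map_base, ← Units.val_inv_eq_inv_val]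
    simp
  · rintro ⟨u, hu, hx⟩
    show L.form _ _ = 2
    apply NumberField.RingOfIntegers.coe_injective
    apply (algebraMap K (AlgebraicClosure K)).injective
    rw [R.form_eq, hx, conj_of_isOfFinOrder hu]
    rw [show (algebraMap (𝓞 K) K) 2 = 2 from h2, map_ofNat]
    simp
    norm_num

theorem base_mem_roots : R.base ∈ L.roots :=
  R.mem_roots_iff.2 ⟨1, IsOfFinOrder.one, by simp [R.map_base]⟩

theorem mem_mu_iff {u : (AlgebraicClosure K)ˣ} :
    u ∈ L.mu ↔ IsOfFinOrder u ∧ ∃ x, R.toFun x = u := by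
  let S : Set (AlgebraicClosure K)ˣ := {u | IsOfFinOrder u ∧ ∃ x, R.toFun x = u}
  have h1 : (1 : (AlgebraicClosure K)ˣ) ∈ S := ⟨IsOfFinOrder.one, R.base, by simp [R.map_base]⟩
  have hS : ∀ x ∈ S, ∀ y ∈ S, x ^ 2 * y⁻¹ ∈ S := by
    rintro u ⟨hu, x, hx⟩ v ⟨hv, y, hy⟩
    -- The negated reflection `(x·y) x - y` of `y` in `x` has image `(u v⁻¹ + u⁻¹ v) u - v = u²
    -- v⁻¹`.
    refine ⟨(hu.pow).mul hv.inv, L.form x y • x - y, ?_⟩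
    rw [map_sub, map_integers_smul, R.form_eq, hx, hy,
      conj_of_isOfFinOrder hu, conj_of_isOfFinOrder hv]
    have := u.ne_zero
    have := v.ne_zero
    push_cast
    field_simp
    ring
  have hmul : ∀ {x y}, x ∈ S → y ∈ S → x * y ∈ S := fun hx hy =>
    mul_mem_of_sq_mul_inv_mem h1 hS (fun x hx => hx.1) hx hy
  have hinv : ∀ {x}, x ∈ S → x⁻¹ ∈ S := fun {x} hx => by simpa using hS 1 h1 x hx
  let H : Subgroup (AlgebraicClosure K)ˣ :=
    { carrier := S, mul_mem' := hmul, one_mem' := h1, inv_mem' := hinv }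
  suffices L.mu = H by rw [this]; rfl
  apply le_antisymm
  · rw [mu, Subgroup.closure_le]
    rintro z ⟨hz, α, hα, β, hβ, h⟩
    obtain ⟨u, hu, hα'⟩ := R.mem_roots_iff.1 hα
    obtain ⟨v, hv, hβ'⟩ := R.mem_roots_iff.1 hβ
    have huS : u ∈ S := ⟨hu, α, hα'⟩
    have hvS : v ∈ S := ⟨hv, β, hβ'⟩
    rw [R.form_eq, hα', hβ', conj_of_isOfFinOrder hu, conj_of_isOfFinOrder hv] at h
    have hu0 := u.ne_zero
    have hv0 := v.ne_zero
    have hz0 := z.ne_zero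
    -- Two numbers with equal values of `z + z⁻¹` coincide or are inverse to each other, so `z` is
    -- `u v⁻¹` or `v u⁻¹`.
    have : (z - u * (v : AlgebraicClosure K)⁻¹ : AlgebraicClosure K) *
        (z - v * (u : AlgebraicClosure K)⁻¹) = 0 := by
      field_simp at h ⊢
      linear_combination h
    rcases mul_eq_zero.1 this with h3 | h3
    · have : z = u * v⁻¹ := Units.ext (by push_cast; exact sub_eq_zero.1 h3)
      rw [this]; exact hmul huS (hinv hvS)
    · have : z = v * u⁻¹ := Units.ext (by push_cast; exact sub_eq_zero.1 h3)
      rw [this]; exact hmul hvS (hinv huS)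
  · rintro u ⟨hu, x, hx⟩
    refine Subgroup.subset_closure ⟨hu, x, R.mem_roots_iff.2 ⟨u, hu, hx⟩, R.base,
      R.base_mem_roots, ?_⟩
    rw [R.form_eq, hx, R.map_base, conj_of_isOfFinOrder hu]
    simp

theorem add_inv_mem (R : L.Realization) {u : (AlgebraicClosure K)ˣ} (hu : u ∈ L.mu) :
    (u + (u : AlgebraicClosure K)⁻¹ : AlgebraicClosure K) ∈
      (algebraMap K (AlgebraicClosure K)).fieldRange := by
  obtain ⟨hf, x, hx⟩ := R.mem_mu_iff.1 hu
  refine ⟨L.form x R.base, ?_⟩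
  rw [R.form_eq, hx, R.map_base, conj_of_isOfFinOrder hf]
  simp

theorem isOfFinOrder_of_mem_mu (R : L.Realization) {u : (AlgebraicClosure K)ˣ} (hu : u ∈ L.mu) : IsOfFinOrder u :=
  (R.mem_mu_iff.1 hu).1

theorem neg_one_mem_mu (R : L.Realization) : -1 ∈ L.mu :=
  R.mem_mu_iff.2 ⟨isOfFinOrder_iff_pow_eq_one.2 ⟨2, two_pos, by simp⟩, -R.base, by
    simp [R.map_base]⟩

theorem range_eq_span : LinearMap.range R.toFun =
    Submodule.span (𝓞 K) (Units.val '' (L.mu : Set (AlgebraicClosure K)ˣ)) := by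
  apply le_antisymm
  · rw [LinearMap.range_eq_map, ← L.span_roots, Submodule.map_span, Submodule.span_le]
    rintro _ ⟨x, hx, rfl⟩
    obtain ⟨u, hu, hxu⟩ := R.mem_roots_iff.1 hx
    exact Submodule.subset_span ⟨u, R.mem_mu_iff.2 ⟨hu, x, hxu⟩, hxu.symm⟩
  · rw [Submodule.span_le]
    rintro _ ⟨u, hu, rfl⟩
    obtain ⟨hf, x, hx⟩ := R.mem_mu_iff.1 hu
    exact ⟨x, hx⟩

theorem isom_of_mu_eq {M : RootLattice K} (R : L.Realization) (R' : M.Realization)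
    (h : L.mu = M.mu) : L.Isom M := by
  have hrange : LinearMap.range R.toFun = LinearMap.range R'.toFun := by
    rw [R.range_eq_span, R'.range_eq_span, h]
  let e := ((LinearEquiv.ofInjective R.toFun R.injective).trans
    (LinearEquiv.ofEq _ _ hrange)).trans (LinearEquiv.ofInjective R'.toFun R'.injective).symm
  have he : ∀ x, R'.toFun (e x) = R.toFun x := fun x => by
    have h1 := LinearEquiv.apply_symm_apply (LinearEquiv.ofInjective R'.toFun R'.injective)
      ((LinearEquiv.ofEq _ _ hrange) ((LinearEquiv.ofInjective R.toFun R.injective) x))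
    exact congrArg Subtype.val h1
  refine ⟨e, fun x y => ?_⟩
  apply NumberField.RingOfIntegers.coe_injective
  apply (algebraMap K (AlgebraicClosure K)).injective
  rw [R'.form_eq, R.form_eq, he, he]

end Realization

end RootLattice

end Realization

/-! ### Classification of root lattices of rank two -/

section Classification

set_option linter.unusedSectionVars false

variable {K : Type u} [Field K] [CharZero K]

theorem exists_integer_eq {x : AlgebraicClosure K}
    (hx : x ∈ (algebraMap K (AlgebraicClosure K)).fieldRange) (hi : IsIntegral ℤ x) :
    ∃ a : 𝓞 K, algebraMap K (AlgebraicClosure K) a = x := by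
  obtain ⟨y, rfl⟩ := hx
  exact ⟨⟨y, (isIntegral_algebraMap_iff (algebraMap K (AlgebraicClosure K)).injective).1 hi⟩, rfl⟩

theorem isIntegral_of_isOfFinOrder {F : Type*} [Field F] {z : Fˣ} (hz : IsOfFinOrder z) :
    IsIntegral ℤ (z : F) :=
  (IsPrimitiveRoot.coe_units_iff.2 (IsPrimitiveRoot.orderOf z)).isIntegral hz.orderOf_pos

theorem isIntegral_sub_inv {F : Type*} [Field F] {z : Fˣ} (hz : IsOfFinOrder z) :
    IsIntegral ℤ (z - (z : F)⁻¹ : F) := by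
  rw [← Units.val_inv_eq_inv_val]
  exact (isIntegral_of_isOfFinOrder hz).sub (isIntegral_of_isOfFinOrder hz.inv)

theorem isIntegral_add_inv {F : Type*} [Field F] {z : Fˣ} (hz : IsOfFinOrder z) :
    IsIntegral ℤ (z + (z : F)⁻¹ : F) := by
  rw [← Units.val_inv_eq_inv_val]
  exact (isIntegral_of_isOfFinOrder hz).add (isIntegral_of_isOfFinOrder hz.inv)

theorem exists_integer_add_inv {n : ℕ} (hn : n ∈ Q K) {w : (AlgebraicClosure K)ˣ}
    (hw : IsPrimitiveRoot w (2 * n)) : ∃ a : 𝓞 K, algebraMap K (AlgebraicClosure K) a =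
      (w + (w : AlgebraicClosure K)⁻¹ : AlgebraicClosure K) := by
  have := hn.1
  exact exists_integer_eq (add_inv_mem_of_mem_Q hn hw)
    (isIntegral_add_inv (isOfFinOrder_of_primitive hw (by lia)))

/-- If `n` is not a prime power, then `1` and a primitive `2n`-th root of unity `w` span all roots
of unity in `K(w)`. -/
theorem exists_eq_add_mul_of_mem_quadOf {n : ℕ} (hn : n ∈ Q K) (hp : ¬ IsPrimePow n)
    {w v : (AlgebraicClosure K)ˣ} (hw : IsPrimitiveRoot w (2 * n)) (hv : v ∈ quadOf K hn hw) :
    ∃ p q : 𝓞 K, (v : AlgebraicClosure K) = algebraMap K (AlgebraicClosure K) p +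
      algebraMap K (AlgebraicClosure K) q * w := by
  have hn1 := hn.1
  have hw0 := w.ne_zero
  have hv0 := v.ne_zero
  have hwf := isOfFinOrder_of_primitive hw (by lia)
  have hd := sub_inv_ne_zero (sq_ne_one_of_primitive hw hn1)
  have hd2 := sub_inv_sq_mem K (add_inv_mem_of_mem_Q hn hw)
  -- `w - w⁻¹ = -w⁻¹ (1 - w²)` is a unit, since `w²` has order `n`, not a prime power.
  have hdi : IsIntegral ℤ (w - (w : AlgebraicClosure K)⁻¹ : AlgebraicClosure K)⁻¹ := by
    have h2 : IsPrimitiveRoot ((w : AlgebraicClosure K) ^ 2) n :=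
      (IsPrimitiveRoot.coe_units_iff.2 hw).pow (by lia) rfl
    have h3 := ((isIntegral_of_isOfFinOrder hwf).mul
      (isIntegral_inv_one_sub h2 hn1 hp)).neg
    have h4 : (1 - (w : AlgebraicClosure K) ^ 2) ≠ 0 := fun h0 => by
      have h1 : (w : AlgebraicClosure K) ^ 2 = 1 := (sub_eq_zero.1 h0).symm
      rw [h1] at h2
      have := h2.unique IsPrimitiveRoot.one
      lia
    have h5 : (w - (w : AlgebraicClosure K)⁻¹ : AlgebraicClosure K) * w =
        -(1 - (w : AlgebraicClosure K) ^ 2) := by field_simp; ring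
    have h6 : (w - (w : AlgebraicClosure K)⁻¹ : AlgebraicClosure K)⁻¹ =
        -(w * (1 - (w : AlgebraicClosure K) ^ 2)⁻¹) := by
      refine inv_eq_of_mul_eq_one_right ?_
      rw [mul_neg, ← mul_assoc, h5, neg_mul, neg_neg, mul_inv_cancel₀ h4]
    rwa [h6]
  have key : ∀ g ∈ quadOf K hn hw, ∃ q : 𝓞 K, algebraMap K (AlgebraicClosure K) q =
      (g - (g : AlgebraicClosure K)⁻¹) * (w - (w : AlgebraicClosure K)⁻¹)⁻¹ := by
    intro g hg
    obtain ⟨hgf, -, hgd⟩ := mem_quadGroup.1 hg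
    refine exists_integer_eq ?_ ((isIntegral_sub_inv hgf).mul hdi)
    have haux : ∀ e d : AlgebraicClosure K, d ≠ 0 → e * d⁻¹ = e * d * (d ^ 2)⁻¹ := by
      intro e d hd
      field_simp
    rw [haux _ _ hd]
    exact mul_mem hgd (inv_mem hd2)
  -- Cramer's rule: conjugating `v = p + q w` yields `v - v⁻¹ = q (w - w⁻¹)` and `v w⁻¹ - v⁻¹ w = -p
  -- (w - w⁻¹)`.
  obtain ⟨q, hq⟩ := key v hv
  obtain ⟨p, hp⟩ := key (v * w⁻¹) (Subgroup.mul_mem _ hv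
    (Subgroup.inv_mem _ (self_mem_quadOf hn hw)))
  refine ⟨-p, q, ?_⟩
  rw [show ((-p : 𝓞 K) : K) = -(p : K) from map_neg _ _, map_neg, hq, hp]
  have e : (v : AlgebraicClosure K) * (w - (w : AlgebraicClosure K)⁻¹) =
      (v - (v : AlgebraicClosure K)⁻¹) * w - ((v * w⁻¹ : (AlgebraicClosure K)ˣ) -
        ((v * w⁻¹ : (AlgebraicClosure K)ˣ) : AlgebraicClosure K)⁻¹) := by
    push_cast
    field_simp
    ring
  refine (eq_div_of_mul_eq hd e).trans ?_
  ring

variable [Algebra.IsAlgebraic ℚ K] [NumberField.IsTotallyReal K]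

namespace RootLattice.Realization

variable {L : RootLattice K} (R : L.Realization)

theorem mem_Q {n : ℕ} (R : L.Realization) (hn : 1 < n) {w : (AlgebraicClosure K)ˣ}
    (hw : IsPrimitiveRoot w (2 * n)) (hwL : w ∈ L.mu) : n ∈ Q K :=
  mem_Q_of_primitive hn hw (R.add_inv_mem hwL)

/-- The upper bound holds because any `g` in `μ(L)` shares with `w` a common root `W` in `μ(L)`, and
`W + W⁻¹` is in `K`. For the lower bound, `𝓞 + 𝓞 w` already contains all of `quadOf`. -/
theorem mu_eq_quadOf (R : L.Realization) {n : ℕ} (hn : n ∈ Q K) (hp : ¬ IsPrimePow n)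
    {w : (AlgebraicClosure K)ˣ} (hw : IsPrimitiveRoot w (2 * n)) (hwL : w ∈ L.mu) :
    L.mu = quadOf K hn hw := by
  have hn1 := hn.1
  apply le_antisymm
  · intro g hg
    obtain ⟨N, hnN, hN, W, hW, -, ⟨i, hi⟩, j, hj⟩ := exists_primitive_two_mul hwL hg (by lia) hw
      (R.isOfFinOrder_of_mem_mu hg)
    rw [← hj]
    refine Subgroup.pow_mem _ (mem_quadGroup_of_pow_mem (k := i)
      (R.isOfFinOrder_of_mem_mu hW) (R.add_inv_mem hW) ?_ ?_) j
    · rw [hi]; exact sq_ne_one_of_primitive hw hn1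
    · rw [hi]; exact self_mem_quadOf hn hw
  · intro v hv
    obtain ⟨p, q, hpq⟩ := exists_eq_add_mul_of_mem_quadOf hn hp hw hv
    obtain ⟨-, x, hx⟩ := R.mem_mu_iff.1 hwL
    refine R.mem_mu_iff.2 ⟨(mem_quadGroup.1 hv).1, p • R.base + q • x, ?_⟩
    rw [map_add, map_integers_smul, map_integers_smul, R.map_base, hx, hpq, mul_one]

theorem mu_eq_zpowers (R : L.Realization) {q : ℕ} (hq : IsPrimePow q)
    {w : (AlgebraicClosure K)ˣ} (hw : IsPrimitiveRoot w (2 * q)) (hwL : w ∈ L.mu)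
    (hR : ∀ x, ∃ a b : 𝓞 K, R.toFun x = algebraMap K (AlgebraicClosure K) a +
      algebraMap K (AlgebraicClosure K) b * w) : L.mu = Subgroup.zpowers w := by
  have := charZero_algebraicClosure (K := K)
  apply le_antisymm
  · intro g hg
    obtain ⟨N, -, hN, W, hW, hWp, ⟨k, hk⟩, j, rfl⟩ := exists_primitive_two_mul hwL hg hq.pos hw
      (R.isOfFinOrder_of_mem_mu hg)
    obtain ⟨hWf, x, hx⟩ := R.mem_mu_iff.1 hW
    obtain ⟨a, b, hab⟩ := hR x
    rw [hx] at hab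
    have hab' := congrArg (RootLat.conj K) hab
    simp only [map_add, map_mul, AlgHom.commutes, conj_of_isOfFinOrder hWf,
      conj_of_isOfFinOrder (R.isOfFinOrder_of_mem_mu hwL)] at hab'
    have hNq : N = q := by
      -- Subtracting from `W = a + b w` its conjugate gives `W - W⁻¹ = b (w - w⁻¹)` with `b`
      -- integral.
      refine eq_of_primitive_of_isIntegral hq hN hw hWp hk
        (y := algebraMap K (AlgebraicClosure K) b) ?_ ?_
      · exact b.2.map (algebraMap K (AlgebraicClosure K)).toIntAlgHom
      · rw [hab', hab]; ring
    subst hNq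
    obtain ⟨i, rfl⟩ := exists_pow_eq_of_primitive (by lia) hw hWp.pow_eq_one
    exact Subgroup.pow_mem _ (Subgroup.npow_mem_zpowers w i) j
  · rwa [Subgroup.zpowers_le]

theorem exists_eq_add_mul_pow {w : (AlgebraicClosure K)ˣ} {a : 𝓞 K}
    (ha : algebraMap K (AlgebraicClosure K) a =
      (w + (w : AlgebraicClosure K)⁻¹ : AlgebraicClosure K)) (k : ℕ) :
    ∃ p q : 𝓞 K, (w : AlgebraicClosure K) ^ k = algebraMap K (AlgebraicClosure K) p +
      algebraMap K (AlgebraicClosure K) q * w := by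
  have hw0 := w.ne_zero
  induction k with
  | zero => exact ⟨1, 0, by simp⟩
  | succ k ih =>
    obtain ⟨p, q, h⟩ := ih
    refine ⟨-q, p + q * a, ?_⟩
    rw [pow_succ, h]
    simp only [map_neg, map_add, map_mul, ha]
    field_simp
    ring

theorem exists_common_power (R : L.Realization) {n : ℕ} {w : (AlgebraicClosure K)ˣ}
    (hn : 1 < n) (hw : IsPrimitiveRoot w (2 * n)) (hwL : w ∈ L.mu)
    (s : Finset (AlgebraicClosure K)) (hs : ∀ z ∈ s, ∃ u ∈ L.mu, (u : AlgebraicClosure K) = z) :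
    ∃ N, 1 < N ∧ ∃ W ∈ L.mu, IsPrimitiveRoot W (2 * N) ∧
      ∀ z ∈ s, ∃ i : ℕ, (W : AlgebraicClosure K) ^ i = z := by
  classical
  induction s using Finset.induction_on with
  | empty => exact ⟨n, hn, w, hwL, hw, by simp⟩
  | insert z s _ ih =>
    obtain ⟨N, hN, W, hW, hWp, h⟩ := ih fun z hz => hs z (Finset.mem_insert_of_mem hz)
    obtain ⟨u, hu, rfl⟩ := hs z (Finset.mem_insert_self _ _)
    obtain ⟨M, hNM, hM, V, hV, hVp, ⟨i, hi⟩, j, hj⟩ := exists_primitive_two_mul hW hu (by lia)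
      hWp (R.isOfFinOrder_of_mem_mu hu)
    refine ⟨M, lt_of_lt_of_le hN (Nat.le_of_dvd hM hNM), V, hV, hVp, fun z hz => ?_⟩
    rcases Finset.mem_insert.1 hz with rfl | hz
    · exact ⟨j, by rw [← hj]; simp⟩
    · obtain ⟨k, hk⟩ := h z hz
      exact ⟨i * k, by rw [← hk, ← hi]; simp [pow_mul]⟩

theorem exists_mu_eq_muOf (R : L.Realization) {ζ : (AlgebraicClosure K)ˣ} (hζ : ζ ∈ L.mu)
    (hζ2 : ζ ^ 2 ≠ 1) : ∃ C ∈ setP K ∪ setR K, L.mu = muOf K C := by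
  have := charZero_algebraicClosure (K := K)
  -- Taking `-1` along with `ζ` makes the order of `w` even, `2n`; since `ζ ≠ ±1`, `n > 1`.
  have hneg : IsPrimitiveRoot (-1 : (AlgebraicClosure K)ˣ) (2 * 1) := by
    rw [← IsPrimitiveRoot.coe_units_iff]
    simpa using IsPrimitiveRoot.neg_one (R := AlgebraicClosure K) 0 (by norm_num)
  obtain ⟨n, -, hn, w, hwL, hw, -, i, hi⟩ := exists_primitive_two_mul R.neg_one_mem_mu hζ
    one_pos hneg (R.isOfFinOrder_of_mem_mu hζ)
  have hn1 : 1 < n := by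
    by_contra h
    have : n = 1 := by lia
    subst this
    apply hζ2
    rw [← hi, ← pow_mul, mul_comm, pow_mul]
    have := hw.pow_eq_one
    rw [mul_one] at this
    rw [this, one_pow]
  by_cases hpp : ∃ n, 1 < n ∧ ¬ IsPrimePow n ∧ ∃ w ∈ L.mu, IsPrimitiveRoot w (2 * n)
  · obtain ⟨m, hm1, hmp, v, hvL, hv⟩ := hpp
    have hm := R.mem_Q hm1 hv hvL
    refine ⟨component K hm, Or.inr (mem_setR_iff.2 ⟨m, hm, hmp, rfl⟩), ?_⟩
    rw [muOf_component hm hv, R.mu_eq_quadOf hm hmp hv hvL]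
  · push Not at hpp
    -- Finitely many elements of `μ(L)` span the image of `L`, and all of them are powers of one `W`
    -- in `μ(L)`, so the image lies in `𝓞 + 𝓞 W`.
    have hfg : (LinearMap.range R.toFun).FG := by
      rw [LinearMap.range_eq_map]
      exact Module.Finite.fg_top.map _
    rw [R.range_eq_span, Submodule.fg_span_iff_fg_span_finset_subset] at hfg
    obtain ⟨s, hs, hspan⟩ := hfg
    obtain ⟨N, hN, W, hW, hWp, hsW⟩ := R.exists_common_power hn1 hw hwL s fun z hz => hs hz
    have hNp : IsPrimePow N := by
      by_contra h
      exact hpp N hN h W hW hWp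
    have hNQ := R.mem_Q hN hWp hW
    refine ⟨{N}, Or.inl ⟨N, hNQ, hNp, rfl⟩, ?_⟩
    rw [muOf_singleton (by lia) hWp]
    refine R.mu_eq_zpowers hNp hWp hW fun x => ?_
    obtain ⟨a, ha⟩ := exists_integer_add_inv hNQ hWp
    have hx : R.toFun x ∈ LinearMap.range R.toFun := ⟨x, rfl⟩
    rw [R.range_eq_span, hspan] at hx
    generalize R.toFun x = y at hx
    induction hx using Submodule.span_induction with
    | mem z hz =>
      obtain ⟨i, hi⟩ := hsW z hz
      rw [← hi]
      exact exists_eq_add_mul_pow ha i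
    | zero => exact ⟨0, 0, by simp⟩
    | add y z _ _ hy hz =>
      obtain ⟨p, q, rfl⟩ := hy
      obtain ⟨p', q', rfl⟩ := hz
      exact ⟨p + p', q + q', by simp only [map_add]; ring⟩
    | smul r y _ hy =>
      obtain ⟨p, q, rfl⟩ := hy
      refine ⟨r * p, r * q, ?_⟩
      have := map_integers_smul (LinearMap.id (R := 𝓞 K) (M := AlgebraicClosure K)) r
        (algebraMap K (AlgebraicClosure K) p + algebraMap K (AlgebraicClosure K) q * W)
      simp only [LinearMap.id_apply] at this
      rw [this]
      simp only [map_mul]; ring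

end RootLattice.Realization

theorem RootLattice.exists_realization_of_rank (L : RootLattice K) (hr : L.rank = 2) :
    ∃ _ : L.Realization, ∃ ζ ∈ L.mu, ζ ^ 2 ≠ 1 := by
  obtain ⟨α, hα, β, hβ, h, h'⟩ := L.exists_root_pair hr
  obtain ⟨ζ, hζ⟩ := exists_units_add_inv
    (algebraMap K (AlgebraicClosure K) (L.form α β))
  obtain ⟨R, hRα, hRβ⟩ := exists_realization hr hα hβ h h' hζ
  have hfin := isOfFinOrder_of_add_inv hζ (L.abs_form_le hα hβ)
  refine ⟨R, ζ, R.mem_mu_iff.2 ⟨hfin, β, hRβ⟩, fun h2 => ?_⟩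
  have hz2 : (ζ : AlgebraicClosure K) ^ 2 = 1 := by simpa using congrArg Units.val h2
  rcases mul_self_eq_one_iff.1 ((sq _).symm.trans hz2) with h3 | h3
  · exact h (R.injective (by rw [hRβ, h3, ← hRα, R.map_base]))
  · exact h' (R.injective (by rw [hRβ, h3, map_neg, ← hRα, R.map_base]))

theorem RootLattice.exists_mu_eq_muOf (L : RootLattice K) (hr : L.rank = 2) :
    ∃ C ∈ setP K ∪ setR K, L.mu = muOf K C := by
  obtain ⟨R, ζ, hζ, hζ2⟩ := L.exists_realization_of_rank hr
  exact R.exists_mu_eq_muOf hζ hζ2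

end Classification

/-! ### Construction of root lattices of rank two -/

section Construction

set_option linter.unusedSectionVars false

variable {K : Type u} [Field K]

/-- The symmetric bilinear form on `𝓞 K × 𝓞 K` with Gram matrix `!![2, a; a, 2]`. -/
noncomputable def planeForm (a : 𝓞 K) : LinearMap.BilinForm (𝓞 K) (𝓞 K × 𝓞 K) :=
  LinearMap.mk₂ (𝓞 K)
    (fun x y => 2 * x.1 * y.1 + a * (x.1 * y.2 + x.2 * y.1) + 2 * x.2 * y.2)
    (by intros; simp; ring) (by intros; simp; ring) (by intros; simp; ring)
    (by intros; simp; ring)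

theorem planeForm_apply (a : 𝓞 K) (x y : 𝓞 K × 𝓞 K) : planeForm a x y =
    2 * x.1 * y.1 + a * (x.1 * y.2 + x.2 * y.1) + 2 * x.2 * y.2 := rfl

/-- The root lattice with basis two roots of inner product `a`. -/
noncomputable def planeLattice (a : 𝓞 K) (ha : ∀ σ : K →+* ℝ, |σ a| < 2) : RootLattice K where
  carrier := 𝓞 K × 𝓞 K
  form := planeForm a
  symm x y := by simp only [planeForm_apply]; ring
  totally_pos σ x hx := by
    have h := abs_lt.1 (ha σ)
    have h2 : ((2 : 𝓞 K) : K) = 2 := rfl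
    have hσ : σ 2 = 2 := map_ofNat σ 2
    simp [planeForm_apply, h2, hσ]
    set s := σ x.1
    set t := σ x.2
    set b := σ a
    have hst : s ≠ 0 ∨ t ≠ 0 := by
      by_contra! h0
      apply hx
      exact Prod.ext (by simpa [s] using h0.1) (by simpa [t] using h0.2)
    have hb : 0 < 4 - b ^ 2 := by nlinarith
    have e : 2 * s * s + b * (s * t + t * s) + 2 * t * t =
        2⁻¹ * ((2 * s + b * t) ^ 2 + (4 - b ^ 2) * t ^ 2) := by ring
    rw [e]
    by_cases ht : t = 0
    · have := hst.resolve_right (not_not.2 ht)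
      rw [ht]
      simp only [mul_zero, add_zero]
      positivity
    · positivity
  span_roots := by
    rw [eq_top_iff]
    rintro ⟨x, y⟩ -
    have h1 : ((1, 0) : 𝓞 K × 𝓞 K) ∈ Submodule.span (𝓞 K) {x | planeForm a x x = 2} :=
      Submodule.subset_span (by simp [planeForm_apply])
    have h2 : ((0, 1) : 𝓞 K × 𝓞 K) ∈ Submodule.span (𝓞 K) {x | planeForm a x x = 2} :=
      Submodule.subset_span (by simp [planeForm_apply])
    have := add_mem (Submodule.smul_mem _ x h1) (Submodule.smul_mem _ y h2)
    simpa using this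

theorem planeLattice_form (a : 𝓞 K) (ha : ∀ σ : K →+* ℝ, |σ a| < 2) (x y : 𝓞 K × 𝓞 K) :
    (planeLattice a ha).form x y =
      2 * x.1 * y.1 + a * (x.1 * y.2 + x.2 * y.1) + 2 * x.2 * y.2 := rfl

variable [CharZero K]

theorem planeLattice_rank (a : 𝓞 K) (ha : ∀ σ : K →+* ℝ, |σ a| < 2) :
    (planeLattice a ha).rank = 2 := by
  show Module.finrank (𝓞 K) (𝓞 K × 𝓞 K) = 2
  simp

theorem abs_add_inv_lt {w : (AlgebraicClosure K)ˣ} (hw : IsOfFinOrder w) (hw2 : w ^ 2 ≠ 1)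
    {a : 𝓞 K} (ha : algebraMap K (AlgebraicClosure K) a =
      (w + (w : AlgebraicClosure K)⁻¹ : AlgebraicClosure K)) (σ : K →+* ℝ) : |σ a| < 2 := by
  obtain ⟨ι, hι⟩ := exists_extension σ
  have h1 := norm_map_eq_one ι hw
  have h2 := congrArg ι ha
  rw [hι, map_add, map_inv₀, Complex.inv_eq_conj h1, Complex.add_conj] at h2
  have h3 : σ a = 2 * (ι w).re := by exact_mod_cast h2
  have him : (ι w).im ≠ 0 := by
    intro h0
    apply hw2
    ext
    apply ι.injective
    have h4 : ι w * ι w = 1 := by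
      have h5 := Complex.inv_eq_conj h1
      have hc : (starRingEnd ℂ) (ι w) = ι w := Complex.conj_eq_iff_im.2 h0
      rw [hc] at h5
      have h6 : ι w ≠ 0 := by simp
      nth_rewrite 1 [← h5]
      exact inv_mul_cancel₀ h6
    simpa [sq] using h4
  have h5 : (ι w).re * (ι w).re + (ι w).im * (ι w).im = 1 := by
    rw [← Complex.normSq_apply, Complex.normSq_eq_norm_sq, h1]; norm_num
  rw [h3, abs_lt]
  have : 0 < (ι w).im * (ι w).im := mul_self_pos.2 him
  constructor <;> nlinarith

variable [Algebra.IsAlgebraic ℚ K] [NumberField.IsTotallyReal K]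

theorem exists_planeLattice_realization {n : ℕ} (hn : n ∈ Q K) {w : (AlgebraicClosure K)ˣ}
    (hw : IsPrimitiveRoot w (2 * n)) : ∃ (a : 𝓞 K) (ha : ∀ σ : K →+* ℝ, |σ a| < 2),
      algebraMap K (AlgebraicClosure K) a =
        (w + (w : AlgebraicClosure K)⁻¹ : AlgebraicClosure K) ∧
      ∃ R : (planeLattice a ha).Realization, ∀ x : 𝓞 K × 𝓞 K, R.toFun x =
        algebraMap K (AlgebraicClosure K) x.1 + algebraMap K (AlgebraicClosure K) x.2 * w := by
  have hn1 := hn.1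
  obtain ⟨a, ha⟩ := exists_integer_add_inv hn hw
  have hlt := abs_add_inv_lt (isOfFinOrder_of_primitive hw (by lia))
    (sq_ne_one_of_primitive hw hn1) ha
  refine ⟨a, hlt, ha, ?_⟩
  let α : (planeLattice a hlt).carrier := ((1, 0) : 𝓞 K × 𝓞 K)
  let β : (planeLattice a hlt).carrier := ((0, 1) : 𝓞 K × 𝓞 K)
  have hα : α ∈ (planeLattice a hlt).roots := by
    show (planeLattice a hlt).form α α = 2
    rw [planeLattice_form]; simp
  have hβ : β ∈ (planeLattice a hlt).roots := by
    show (planeLattice a hlt).form β β = 2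
    rw [planeLattice_form]; simp
  have h1 : β ≠ α := fun h => by
    have : (0 : 𝓞 K) = 1 := congrArg Prod.fst h
    simp at this
  have h2 : β ≠ -α := fun h => by
    have : (1 : 𝓞 K) = -0 := congrArg Prod.snd h
    simp at this
  have hf : (planeLattice a hlt).form α β = a := by
    rw [planeLattice_form]; simp
  obtain ⟨R, hRα, hRβ⟩ := RootLattice.exists_realization (planeLattice_rank a hlt) hα hβ h1 h2
    (ζ := w) (by rw [hf, ha])
  refine ⟨R, fun x => ?_⟩
  have hx : (x : (planeLattice a hlt).carrier) = x.1 • α + x.2 • β := by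
    show x = x.1 • ((1, 0) : 𝓞 K × 𝓞 K) + x.2 • ((0, 1) : 𝓞 K × 𝓞 K)
    ext <;> simp
  have hRx := congrArg R.toFun hx
  rw [hRx, map_add, RootLattice.map_integers_smul, RootLattice.map_integers_smul, hRβ,
    ← hRα, R.map_base, mul_one]

theorem mem_mu_of_toFun_eq {L : RootLattice K} (R : L.Realization) {n : ℕ} (hn : 0 < n)
    {w : (AlgebraicClosure K)ˣ} (hw : IsPrimitiveRoot w n) {x : L.carrier} (hx : R.toFun x = w) :
    w ∈ L.mu :=
  R.mem_mu_iff.2 ⟨isOfFinOrder_of_primitive hw hn, x, hx⟩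

/-- The lattice `𝓞 + 𝓞 w` serves in both cases; for a component, `w` belongs to any of its members
that is not a prime power. -/
theorem exists_lattice_mu_eq {C : Set ℕ} (hC : C ∈ setP K ∪ setR K) :
    ∃ L : RootLattice K, L.rank = 2 ∧ L.mu = muOf K C := by
  have key : ∀ n ∈ Q K, ∃ w : (AlgebraicClosure K)ˣ, IsPrimitiveRoot w (2 * n) ∧
      ∃ L : RootLattice K, L.rank = 2 ∧ w ∈ L.mu ∧ ∃ R : L.Realization, ∀ x, ∃ a b : 𝓞 K,
        R.toFun x = algebraMap K (AlgebraicClosure K) a +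
          algebraMap K (AlgebraicClosure K) b * w := by
    intro n hn
    have hn1 := hn.1
    obtain ⟨w, hw⟩ := exists_primitive_units (K := K) (n := n) (by lia)
    obtain ⟨a, ha, -, R, hR⟩ := exists_planeLattice_realization hn hw
    refine ⟨w, hw, planeLattice a ha, planeLattice_rank a ha, ?_, R, fun x => ⟨_, _, hR x⟩⟩
    exact mem_mu_of_toFun_eq R (by lia) hw (x := ((0, 1) : 𝓞 K × 𝓞 K)) (by rw [hR]; simp)
  rcases hC with ⟨q, hq, hqp, rfl⟩ | hC
  · obtain ⟨w, hw, L, hr, hwL, R, hR⟩ := key q hq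
    exact ⟨L, hr, by rw [R.mu_eq_zpowers hqp hw hwL hR, muOf_singleton hqp.pos hw]⟩
  · obtain ⟨n, hn, hnp, rfl⟩ := mem_setR_iff.1 hC
    obtain ⟨w, hw, L, hr, hwL, R, hR⟩ := key n hn
    exact ⟨L, hr, by rw [R.mu_eq_quadOf hn hnp hw hwL, muOf_component hn hw]⟩

theorem bijOn_mu : Set.BijOn (RankTwoClasses.mu (K := K)) Set.univ
    (muOf K '' (setP K ∪ setR K)) := by
  refine ⟨?_, ?_, ?_⟩
  · intro c _
    induction c using Quotient.inductionOn with
    | h L =>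
      obtain ⟨C, hC, h⟩ := L.1.exists_mu_eq_muOf L.2
      exact ⟨C, hC, h.symm⟩
  · intro c _ c' _
    induction c, c' using Quotient.inductionOn₂ with
    | h L M =>
      intro h
      obtain ⟨R, -⟩ := L.1.exists_realization_of_rank L.2
      obtain ⟨R', -⟩ := M.1.exists_realization_of_rank M.2
      exact Quotient.sound (R.isom_of_mu_eq R' h)
  · rintro _ ⟨C, hC, rfl⟩
    obtain ⟨L, hr, h⟩ := exists_lattice_mu_eq hC
    exact ⟨Quotient.mk _ ⟨L, hr⟩, trivial, h⟩

end Construction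

/-! ### Irreducibility -/

section Irreducible

set_option linter.unusedSectionVars false

variable {K : Type u} [Field K] [CharZero K] [Algebra.IsAlgebraic ℚ K]
  [NumberField.IsTotallyReal K]

/-- A nonzero integer of a number field has norm at least one in absolute value. -/
theorem eq_zero_of_abs_lt_one [FiniteDimensional ℚ K] {a : 𝓞 K}
    (ha : ∀ σ : K →+* ℝ, |σ a| < 1) : a = 0 := by
  have : NumberField K := ⟨⟩
  by_contra h0
  have hlt : ∀ z : NumberField.InfinitePlace K, z a < 1 := fun z => by
    rw [← NumberField.InfinitePlace.norm_embedding_of_isReal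
      (NumberField.IsTotallyReal.isReal z), Real.norm_eq_abs]
    exact ha _
  obtain ⟨z⟩ : Nonempty (NumberField.InfinitePlace K) := inferInstance
  exact absurd (NumberField.InfinitePlace.one_le_of_lt_one h0 fun z _ => hlt z)
    (not_le.2 (hlt z))

theorem not_isUnit_two_integers : ¬ IsUnit (2 : 𝓞 K) := by
  rintro h
  obtain ⟨r, hr⟩ := h.exists_right_inv
  apply not_isIntegral_inv_natCast (F := K) Nat.prime_two
  have h2 : ((2 : 𝓞 K) : K) = 2 := rfl
  have h1 : ((2 : ℕ) : K) * r = 1 := by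
    have := congrArg (fun s : 𝓞 K => (s : K)) hr
    simpa [h2] using this
  rw [← eq_inv_of_mul_eq_one_right h1]
  exact r.2

namespace RootLattice

variable (L : RootLattice K)

theorem eq_zero_of_form_self {x : L.carrier} (h : L.form x x = 0) : x = 0 := by
  by_contra h0
  obtain ⟨σ⟩ := nonempty_real_embedding K
  have := L.totally_pos σ x h0
  simp [h] at this

theorem eq_zero_of_orthogonal (hr : L.rank = 2) {x y z : L.carrier} (hx : L.form x x = 1)
    (hy : L.form y y = 1) (hxy : L.form x y = 0) (hxz : L.form x z = 0) (hyz : L.form y z = 0) :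
    z = 0 := by
  have hn : ¬ LinearIndependent (𝓞 K) ![x, y, z] := fun hli => by
    have := hli.fintype_card_le_finrank
    have hr' : Module.finrank (𝓞 K) L.carrier = 2 := hr
    simp [hr'] at this
  obtain ⟨g, hg, i, hi⟩ := Fintype.not_linearIndependent_iff.1 hn
  simp [Fin.sum_univ_three] at hg
  have h0 : g 0 = 0 := by
    have := congrArg (L.form x) hg
    simpa [hx, hxy, hxz] using this
  have h1 : g 1 = 0 := by
    have := congrArg (L.form y) hg
    simpa [hy, L.symm y x, hxy, hyz] using this
  have h2 : g 2 ≠ 0 := by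
    intro h2
    fin_cases i <;> simp_all
  apply L.eq_zero_of_form_self
  have := congrArg (L.form z) hg
  simpa [L.symm z x, L.symm z y, hxz, hyz, h2] using this

/-- The norms of `x` and `y` are totally positive with sum two, so `x·x - 1` lies strictly between
`-1` and `1` in every embedding. -/
theorem form_self_eq_one [FiniteDimensional ℚ K] {x y : L.carrier} (h : x + y ∈ L.roots)
    (hxy : L.form x y = 0) (hx : x ≠ 0) (hy : y ≠ 0) : L.form x x = 1 := by
  rw [← sub_eq_zero]
  apply eq_zero_of_abs_lt_one
  intro σ
  have h' : L.form (x + y) (x + y) = 2 := h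
  have h1 := L.totally_pos σ x hx
  have h2 := L.totally_pos σ y hy
  have h3 : L.form x x + L.form y y = 2 := by
    rw [← h']; simp [L.symm y x, hxy]
  have h4 : σ (L.form x x) + σ (L.form y y) = 2 := by
    rw [← map_add, ← map_ofNat σ 2]
    exact congrArg (fun r : 𝓞 K => σ (r : K)) h3
  have h5 : σ ((L.form x x - 1 : 𝓞 K) : K) = σ (L.form x x) - 1 := by
    rw [show ((L.form x x - 1 : 𝓞 K) : K) = (L.form x x : K) - 1 from rfl]
    simp
  rw [h5, abs_lt]
  constructor <;> linarith

theorem irreducible_of_form_ne_zero [FiniteDimensional ℚ K] (hr : L.rank = 2) {α β : L.carrier}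
    (hα : α ∈ L.roots) (hβ : β ∈ L.roots) (h : β ≠ α) (h' : β ≠ -α) (hαβ : L.form α β ≠ 0) :
    L.Irreducible := by
  rintro ⟨L₁, L₂, h1, h2, -, -, -, -, hc, horth⟩
  have hdec : ∀ x, ∃ x₁ ∈ L₁, ∃ x₂ ∈ L₂, x₁ + x₂ = x := fun x =>
    Submodule.mem_sup.1 (hc.sup_eq_top ▸ Submodule.mem_top)
  -- A root may a priori be split by the decomposition. Then its parts `x₁`, `x₂` are orthonormal,
  -- and parity modulo two rules this out.
  by_cases hex : ∃ x₁ ∈ L₁, ∃ x₂ ∈ L₂, x₁ + x₂ ∈ L.roots ∧ x₁ ≠ 0 ∧ x₂ ≠ 0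
  · obtain ⟨x₁, hx₁, x₂, hx₂, hx, h01, h02⟩ := hex
    have hx12 := horth _ hx₁ _ hx₂
    have he1 := L.form_self_eq_one hx hx12 h01 h02
    have he2 := L.form_self_eq_one (add_comm x₁ x₂ ▸ hx) (by rw [L.symm, hx12]) h02 h01
    have key : ∀ z : L.carrier, L.form (x₁ + x₂) z ∈ (Ideal.span {(2 : 𝓞 K)}).radical := by
      intro z
      have hz : z ∈ Submodule.span (𝓞 K) {x | L.form x x = 2} := L.span_roots ▸ Submodule.mem_top
      induction hz using Submodule.span_induction with
      | mem y hy =>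
        obtain ⟨y₁, hy₁, y₂, hy₂, rfl⟩ := hdec y
        have hc1 : y₁ - L.form x₁ y₁ • x₁ = 0 :=
          L.eq_zero_of_orthogonal hr he1 he2 hx12 (by simp [he1])
            (by rw [L.symm]; exact horth _ (sub_mem hy₁ (L₁.smul_mem _ hx₁)) _ hx₂)
        have hc2 : y₂ - L.form x₂ y₂ • x₂ = 0 :=
          L.eq_zero_of_orthogonal hr he1 he2 hx12
            (horth _ hx₁ _ (sub_mem hy₂ (L₂.smul_mem _ hx₂))) (by simp [he2])
        set c := L.form x₁ y₁
        set d := L.form x₂ y₂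
        rw [sub_eq_zero] at hc1 hc2
        -- A root is `c x₁ + d x₂` with `c² + d² = 2`, and its product with `x₁ + x₂` is `c + d`,
        -- where `(c + d)² = 2 (1 + c d)`.
        refine ⟨2, Ideal.mem_span_singleton.2 ⟨1 + c * d, ?_⟩⟩
        have hy' : L.form (y₁ + y₂) (y₁ + y₂) = 2 := hy
        rw [hc1, hc2] at hy' ⊢
        simp [he1, he2, hx12, L.symm x₂ x₁] at hy' ⊢
        linear_combination hy'
      | zero => simp
      | add y z _ _ hy hz => rw [map_add]; exact add_mem hy hz
      | smul r y _ hy => rw [map_smul]; exact Ideal.mul_mem_left _ r hy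
    -- But the product of `x₁ + x₂` with `x₁` is `1`, which would make `2` a unit.
    obtain ⟨n, hn⟩ := key x₁
    rw [map_add, LinearMap.add_apply, he1, L.symm x₂ x₁, hx12, add_zero, one_pow,
      Ideal.mem_span_singleton] at hn
    exact not_isUnit_two_integers (K := K) (isUnit_of_dvd_one hn)
  · push Not at hex
    have hmem : ∀ x ∈ L.roots, x ∈ L₁ ∨ x ∈ L₂ := by
      intro x hx
      obtain ⟨x₁, hx₁, x₂, hx₂, rfl⟩ := hdec x
      by_cases h0 : x₁ = 0
      · right; simpa [h0] using hx₂
      · left; simpa [hex x₁ hx₁ x₂ hx₂ hx h0] using hx₁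
    have hzero : ∀ z, L.form α z = 0 → L.form β z = 0 → z = 0 := by
      intro z hz1 hz2
      obtain ⟨r, p, q, hr0, hz⟩ := L.exists_smul_eq hr hα hβ h h' z
      apply L.eq_zero_of_form_self
      have := congrArg (L.form z) hz
      simpa [L.symm z α, L.symm z β, hz1, hz2, hr0] using this
    -- Since `α·β ≠ 0`, both lie in the same summand; the other is orthogonal to both and hence
    -- zero.
    rcases hmem α hα with ha | ha <;> rcases hmem β hβ with hb | hb
    · exact h2 ((Submodule.eq_bot_iff _).2 fun z hz =>
        hzero z (horth _ ha _ hz) (horth _ hb _ hz))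
    · exact hαβ (horth _ ha _ hb)
    · exact hαβ (by rw [L.symm]; exact horth _ hb _ ha)
    · exact h1 ((Submodule.eq_bot_iff _).2 fun z hz =>
        hzero z (by rw [L.symm]; exact horth _ hz _ ha) (by rw [L.symm]; exact horth _ hz _ hb))

end RootLattice

end Irreducible

/-! ### Fundamental systems of two roots -/

section FundamentalSystem

variable {K : Type u} [Field K]

theorem exists_finsupp_pair_iff (φ : K →+* ℝ) {M : Type*} [AddCommGroup M] [Module (𝓞 K) M]
    {α β : M} (h : α ≠ β) (x : M) :
    (∃ c : ({α, β} : Set M) →₀ 𝓞 K, (c.sum fun γ a => a • (γ : M)) = x ∧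
      ((∀ γ, c γ = 0 ∨ 1 ≤ φ (c γ : K)) ∨ (∀ γ, c γ = 0 ∨ 1 ≤ φ (-(c γ : K))))) ↔
    ∃ s t : 𝓞 K, s • α + t • β = x ∧
      (((s = 0 ∨ 1 ≤ φ s) ∧ (t = 0 ∨ 1 ≤ φ t)) ∨
        ((s = 0 ∨ 1 ≤ φ (-s)) ∧ (t = 0 ∨ 1 ≤ φ (-t)))) := by
  classical
  have hα : α ∈ ({α, β} : Set M) := Or.inl rfl
  have hβ : β ∈ ({α, β} : Set M) := Or.inr rfl
  have hne : (⟨α, hα⟩ : ({α, β} : Set M)) ≠ ⟨β, hβ⟩ := fun h0 => h (congrArg Subtype.val h0)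
  have hcases : ∀ γ : ({α, β} : Set M), γ = ⟨α, hα⟩ ∨ γ = ⟨β, hβ⟩ := by
    rintro ⟨γ, rfl | hγ⟩
    · exact Or.inl rfl
    · right; exact Subtype.ext hγ
  have hsum : ∀ c : ({α, β} : Set M) →₀ 𝓞 K, (c.sum fun γ a => a • (γ : M)) =
      c ⟨α, hα⟩ • α + c ⟨β, hβ⟩ • β := by
    intro c
    rw [Finsupp.sum_of_support_subset c (s := {⟨α, hα⟩, ⟨β, hβ⟩}) (fun γ _ => by
      rcases hcases γ with rfl | rfl <;> simp) _ (by simp), Finset.sum_pair hne]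
  constructor
  · rintro ⟨c, hx, hc⟩
    refine ⟨_, _, (hsum c).symm.trans hx, ?_⟩
    exact hc.imp (fun h => ⟨h _, h _⟩) (fun h => ⟨h _, h _⟩)
  · rintro ⟨s, t, hx, hst⟩
    let c : ({α, β} : Set M) →₀ 𝓞 K := Finsupp.single ⟨α, hα⟩ s + Finsupp.single ⟨β, hβ⟩ t
    have hcα : c ⟨α, hα⟩ = s := by simp [c, h.symm]
    have hcβ : c ⟨β, hβ⟩ = t := by simp [c, h]
    refine ⟨c, by rw [hsum, hcα, hcβ, hx], ?_⟩
    refine hst.imp ?_ ?_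
    · rintro ⟨h1, h2⟩ γ
      rcases hcases γ with rfl | rfl
      · rwa [hcα]
      · rwa [hcβ]
    · rintro ⟨h1, h2⟩ γ
      rcases hcases γ with rfl | rfl
      · rwa [hcα]
      · rwa [hcβ]

theorem exists_basis_pair {R M : Type*} [CommRing R] [AddCommGroup M] [Module R M] {α β : M}
    (hli : ∀ p q : R, p • α + q • β = 0 → p = 0 ∧ q = 0) (hsp : ∀ x, ∃ p q : R, p • α + q • β = x) :
    ∃ b : Module.Basis (Fin 2) R M, b 0 = α ∧ b 1 = β := by
  refine ⟨Module.Basis.mk (v := ![α, β]) (LinearIndependent.pair_iff.2 hli) ?_, ?_, ?_⟩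
  · intro x _
    obtain ⟨p, q, rfl⟩ := hsp x
    exact add_mem (Submodule.smul_mem _ _ (Submodule.subset_span ⟨0, rfl⟩))
      (Submodule.smul_mem _ _ (Submodule.subset_span ⟨1, rfl⟩))
  · simp
  · simp

/-- The definition asks for a basis over `K` only; since the roots generate `L` and have
coefficients in `𝓞`, it is a basis over `𝓞`. -/
theorem RootLattice.IsFundamentalSystem.exists_basis {φ : K →+* ℝ} {L : RootLattice K}
    {α β : L.carrier} (h : α ≠ β) (hL : L.IsFundamentalSystem φ {α, β}) :
    ∃ b : Module.Basis (Fin 2) (𝓞 K) L.carrier, b 0 = α ∧ b 1 = β := by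
  obtain ⟨-, hli, -, hco⟩ := hL
  refine exists_basis_pair (fun p q hpq => ?_) (fun x => ?_)
  · rw [LinearIndepOn.pair_iff _ h] at hli
    have h1 := hli (p : K) (q : K) (by
      have := congrArg (fun x => (1 : K) ⊗ₜ[𝓞 K] x) hpq
      simp only [TensorProduct.tmul_add, TensorProduct.tmul_smul, TensorProduct.tmul_zero] at this
      rw [← this]
      simp only [TensorProduct.smul_tmul', Algebra.smul_def, mul_one]
      rfl)
    exact ⟨by simpa using h1.1, by simpa using h1.2⟩
  · have hx : x ∈ Submodule.span (𝓞 K) {x | L.form x x = 2} := L.span_roots ▸ Submodule.mem_top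
    induction hx using Submodule.span_induction with
    | mem y hy =>
      obtain ⟨s, t, hst, -⟩ := (exists_finsupp_pair_iff φ h y).1 (hco y hy)
      exact ⟨s, t, hst⟩
    | zero => exact ⟨0, 0, by simp⟩
    | add y z _ _ hy hz =>
      obtain ⟨p, q, rfl⟩ := hy
      obtain ⟨p', q', rfl⟩ := hz
      exact ⟨p + p', q + q', by simp only [add_smul]; abel⟩
    | smul r y _ hy =>
      obtain ⟨p, q, rfl⟩ := hy
      exact ⟨r * p, r * q, by simp only [mul_smul, smul_add]⟩

theorem RootLattice.isFundamentalSystem_of_basis {φ : K →+* ℝ} {L : RootLattice K}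
    {α β : L.carrier} (h : α ≠ β) (hα : α ∈ L.roots) (hβ : β ∈ L.roots)
    (b : Module.Basis (Fin 2) (𝓞 K) L.carrier) (h0 : b 0 = α) (h1 : b 1 = β)
    (hco : ∀ x ∈ L.roots, ∃ s t : 𝓞 K, s • α + t • β = x ∧
      (((s = 0 ∨ 1 ≤ φ s) ∧ (t = 0 ∨ 1 ≤ φ t)) ∨
        ((s = 0 ∨ 1 ≤ φ (-s)) ∧ (t = 0 ∨ 1 ≤ φ (-t))))) :
    L.IsFundamentalSystem φ {α, β} := by
  have hb0 : b.baseChange K 0 = (1 : K) ⊗ₜ[𝓞 K] α := by rw [Module.Basis.baseChange_apply, h0]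
  have hb1 : b.baseChange K 1 = (1 : K) ⊗ₜ[𝓞 K] β := by rw [Module.Basis.baseChange_apply, h1]
  have hv : ⇑(b.baseChange K) = ![(1 : K) ⊗ₜ[𝓞 K] α, (1 : K) ⊗ₜ[𝓞 K] β] := by
    ext i
    fin_cases i
    · exact hb0
    · exact hb1
  refine ⟨?_, ?_, ?_, fun x hx => (exists_finsupp_pair_iff φ h x).2 (hco x hx)⟩
  · rintro x (rfl | rfl)
    · exact hα
    · exact hβ
  · rw [LinearIndepOn.pair_iff _ h]
    have := (b.baseChange K).linearIndependent
    rw [hv] at this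
    exact LinearIndependent.pair_iff.1 this
  · have := (b.baseChange K).span_eq
    rw [hv, Matrix.range_cons, Matrix.range_cons, Matrix.range_empty, Set.union_empty] at this
    rw [Set.image_pair, ← this]
    rfl

end FundamentalSystem

/-! ### Angles -/

section Angles

set_option linter.unusedSectionVars false

variable {K : Type u} [Field K] [CharZero K]

theorem exists_primitive_exp (ι : AlgebraicClosure K →+* ℂ) {m : ℕ} (hm : 0 < m) :
    ∃ w : (AlgebraicClosure K)ˣ, IsPrimitiveRoot w (2 * m) ∧
      ι w = Complex.exp ((Real.pi / m : ℝ) * Complex.I) := by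
  obtain ⟨u, hu⟩ := exists_primitive_units (K := K) hm
  have hne : NeZero (2 * m) := ⟨by lia⟩
  have hu' := (IsPrimitiveRoot.coe_units_iff.2 hu).map_of_injective ι.injective
  have he := Complex.isPrimitiveRoot_exp (2 * m) (by lia)
  have harg : 2 * (Real.pi : ℂ) * Complex.I / (2 * m : ℕ) = (Real.pi / m : ℝ) * Complex.I := by
    have : (m : ℂ) ≠ 0 := by exact_mod_cast hm.ne'
    push_cast
    field_simp
  rw [harg] at he
  obtain ⟨i, -, hi⟩ := hu'.eq_pow_of_pow_eq_one he.pow_eq_one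
  have hw : ι (u ^ i : (AlgebraicClosure K)ˣ) = Complex.exp ((Real.pi / m : ℝ) * Complex.I) := by
    rw [← hi]; simp
  refine ⟨u ^ i, ?_, hw⟩
  rw [← hw] at he
  exact IsPrimitiveRoot.coe_units_iff.1 (IsPrimitiveRoot.of_map_of_injective he ι.injective)

theorem map_add_inv_eq_cos {F : Type*} [Field F] (ι : F →+* ℂ) {w : F} {θ : ℝ}
    (h : ι w = Complex.exp (θ * Complex.I)) : ι (w + w⁻¹) = (2 * Real.cos θ : ℝ) := by
  rw [map_add, map_inv₀, h, ← Complex.exp_neg]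
  push_cast
  rw [Complex.cos]
  ring_nf

theorem map_sub_inv_eq_sin {F : Type*} [Field F] (ι : F →+* ℂ) {w : F} {θ : ℝ}
    (h : ι w = Complex.exp (θ * Complex.I)) :
    ι (w - w⁻¹) = 2 * Complex.I * (Real.sin θ : ℝ) := by
  rw [map_sub, map_inv₀, h, ← Complex.exp_neg]
  push_cast
  rw [Complex.sin, neg_mul]
  linear_combination (Complex.exp (θ * Complex.I) - Complex.exp (-(θ * Complex.I))) *
    Complex.I_sq

theorem mem_Q_iff_two_mul_cos_mem_range (φ : K →+* ℝ) {m : ℕ} (hm : 1 < m) :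
    m ∈ Q K ↔ 2 * Real.cos (Real.pi / m) ∈ φ.range := by
  obtain ⟨ι, hι⟩ := exists_extension φ
  obtain ⟨w, hw, hιw⟩ := exists_primitive_exp ι (m := m) (by lia)
  have hcos := map_add_inv_eq_cos ι hιw
  constructor
  · intro h
    obtain ⟨x, hx⟩ := add_inv_mem_of_mem_Q h hw
    refine ⟨x, ?_⟩
    rw [← hx, hι] at hcos
    exact_mod_cast hcos
  · rintro ⟨x, hx⟩
    refine mem_Q_of_primitive hm hw ⟨x, ι.injective ?_⟩
    rw [hι, hx, hcos]

theorem sin_pi_div_le {m j : ℕ} (hj : 1 ≤ j) (hjm : j < m) :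
    Real.sin (Real.pi / m) ≤ Real.sin (j * (Real.pi / m)) := by
  have hpi := Real.pi_pos
  have hm : (0 : ℝ) < m := by exact_mod_cast (by lia : 0 < m)
  have hd : 0 < Real.pi / m := by positivity
  have hj' : (1 : ℝ) ≤ j := by exact_mod_cast hj
  have hjm' : (j : ℝ) + 1 ≤ m := by exact_mod_cast hjm
  have hmd : m * (Real.pi / m) = Real.pi := by field_simp
  rcases le_total (j * (Real.pi / m)) (Real.pi / 2) with h | h
  · exact Real.sin_le_sin_of_le_of_le_pi_div_two (by linarith) h (by nlinarith)
  · rw [← Real.sin_pi_sub (j * (Real.pi / m))]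
    exact Real.sin_le_sin_of_le_of_le_pi_div_two (by linarith) (by linarith) (by nlinarith)

theorem sin_pi_div_pos {m : ℕ} (hm : 1 < m) : 0 < Real.sin (Real.pi / m) := by
  have hpi := Real.pi_pos
  have hm' : (1 : ℝ) < m := by exact_mod_cast hm
  exact Real.sin_pos_of_pos_of_lt_pi (by positivity) (by rw [div_lt_iff₀ (by linarith)]; nlinarith)

/-- The sine vanishes at `j = 0` and `j = m`, and in between it is at least `sin(π/m)`. -/
theorem eq_zero_or_one_le_of_mul_sin (φ : K →+* ℝ) {m j : ℕ} (hm : 1 < m) (hj : j ≤ m) {t : K}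
    (h : φ t * Real.sin (Real.pi / m) = Real.sin (j * (Real.pi / m))) : t = 0 ∨ 1 ≤ φ t := by
  have hs := sin_pi_div_pos hm
  have hzero : Real.sin (j * (Real.pi / m)) = 0 → t = 0 := fun h0 => by
    rw [h0] at h
    have := (mul_eq_zero.1 h).resolve_right hs.ne'
    simpa using this
  rcases Nat.eq_zero_or_pos j with rfl | hj0
  · exact Or.inl (hzero (by simp))
  rcases hj.eq_or_lt with rfl | hlt
  · left
    apply hzero
    have : (j : ℝ) ≠ 0 := by exact_mod_cast hj0.ne'
    rw [mul_div_cancel₀ _ this, Real.sin_pi]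
  · right
    have := sin_pi_div_le hj0 hlt
    rw [← h] at this
    nlinarith

end Angles

/-! ### Lattices of type `I₂(m)` -/

section Dihedral

set_option linter.unusedSectionVars false

variable {K : Type u} [Field K] [CharZero K]

theorem isMaximalInQ_iff {m : ℕ} (hm : m ∈ Q K) :
    IsMaximalInQ K m ↔ ∀ p, p.Prime → m * p ∉ Q K := by
  have hm1 := hm.1
  constructor
  · rintro ⟨_, h⟩ p hp hmp
    have := h ⟨m * p, hmp⟩ (Relation.ReflTransGen.single ⟨Dvd.intro _ rfl, by
      simpa [Nat.mul_div_cancel_left p (show 0 < m by lia)] using hp⟩)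
    have := hp.one_lt
    simp only at *
    nlinarith
  · refine fun h => ⟨hm, fun y hy => ?_⟩
    rcases Relation.ReflTransGen.cases_head hy with hy | ⟨z, hz, -⟩
    · exact congrArg Subtype.val hy.symm
    · exfalso
      refine h _ hz.2 ?_
      rw [Nat.mul_div_cancel' hz.1]
      exact z.2

theorem eq_of_isMaximalInQ {m N : ℕ} (hm : m ∈ Q K) (h : IsMaximalInQ K m) (hN : N ∈ Q K)
    (hd : m ∣ N) : N = m := by
  have hm1 := hm.1
  obtain ⟨k, rfl⟩ := hd
  by_contra hne
  have hk : k ≠ 1 := by rintro rfl; simp at hne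
  obtain ⟨p, hp, l, rfl⟩ := Nat.exists_prime_and_dvd hk
  refine (isMaximalInQ_iff hm).1 h p hp (mem_Q_of_dvd hN ?_ ⟨l, by ring⟩)
  have := hp.one_lt
  nlinarith

variable [Algebra.IsAlgebraic ℚ K] [NumberField.IsTotallyReal K]

theorem RootLattice.IsOfTypeI₂.mem_Q_and {φ : K →+* ℝ} {L : RootLattice K} {m : ℕ} (hm : 3 ≤ m)
    (hL : L.IsOfTypeI₂ φ m) : m ∈ Q K ∧ (IsPrimePow m ∨ IsMaximalInQ K m) := by
  obtain ⟨α, β, hαβ, hfs, hform⟩ := hL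
  obtain ⟨b, hb0, hb1⟩ := hfs.exists_basis hαβ
  have hr : L.rank = 2 := by
    show Module.finrank (𝓞 K) L.carrier = 2
    rw [Module.finrank_eq_card_basis b]; simp
  have hα : α ∈ L.roots := hfs.1 (Or.inl rfl)
  have hβ : β ∈ L.roots := hfs.1 (Or.inr rfl)
  have hne : β ≠ -α := by
    intro h
    rw [← hb0, ← hb1] at h
    have := congrArg (fun x => b.repr x 1) h
    simp at this
  obtain ⟨ι, hι⟩ := exists_extension φ
  obtain ⟨w, hw, hιw⟩ := exists_primitive_exp ι (m := m) (by lia)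
  have hwf := isOfFinOrder_of_primitive hw (by lia)
  -- `-w⁻¹` is at angle `π - π/m`, which accounts for `α·β = -2 cos(π/m)`.
  have hζ : ((-w⁻¹ : (AlgebraicClosure K)ˣ) + ((-w⁻¹ : (AlgebraicClosure K)ˣ) :
      AlgebraicClosure K)⁻¹ : AlgebraicClosure K) =
      algebraMap K (AlgebraicClosure K) (L.form α β) := by
    apply ι.injective
    rw [hι, hform]
    have := map_add_inv_eq_cos ι hιw
    have e : ((-w⁻¹ : (AlgebraicClosure K)ˣ) + ((-w⁻¹ : (AlgebraicClosure K)ˣ) :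
      AlgebraicClosure K)⁻¹ : AlgebraicClosure K) = -(w + (w : AlgebraicClosure K)⁻¹) := by
      push_cast
      rw [inv_neg, inv_inv]; ring
    rw [e, map_neg, this]
    push_cast; ring
  obtain ⟨R, hRα, hRβ⟩ := exists_realization hr hα hβ hαβ.symm hne hζ
  have hwL : w ∈ L.mu := by
    have h1 : -w⁻¹ ∈ L.mu := by
      obtain ⟨u, hu, hβu⟩ := R.mem_roots_iff.1 hβ
      have : u = -w⁻¹ := Units.ext (hβu.symm.trans hRβ)
      exact R.mem_mu_iff.2 ⟨this ▸ hu, β, hRβ⟩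
    have := L.mu.mul_mem R.neg_one_mem_mu (L.mu.inv_mem h1)
    simpa using this
  have hmQ := R.mem_Q (by lia) hw hwL
  refine ⟨hmQ, or_iff_not_imp_left.2 fun hmp => (isMaximalInQ_iff hmQ).2 fun p hp hmpQ => ?_⟩
  have hp1 := hp.one_lt
  obtain ⟨v, hv, hιv⟩ := exists_primitive_exp ι (m := m * p) (by nlinarith)
  have hvf := isOfFinOrder_of_primitive hv (by nlinarith)
  have hvp : IsPrimitiveRoot (v ^ p) (2 * m) := hv.pow (by nlinarith) (by ring)
  -- As `m` is not a prime power, `μ(L)` contains all roots of unity of `K(w)`, and `v` is one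
  -- because its power `v ^ p` is.
  have hvL : v ∈ L.mu := by
    rw [R.mu_eq_quadOf hmQ hmp hw hwL]
    refine mem_quadGroup_of_pow_mem hvf (add_inv_mem_of_mem_Q hmpQ hv) (k := p)
      (sq_ne_one_of_primitive hvp (by lia)) ?_
    obtain ⟨i, hi⟩ := exists_pow_eq_of_primitive (by lia) hw hvp.pow_eq_one
    rw [← hi]
    exact Subgroup.pow_mem _ (self_mem_quadOf hmQ hw) i
  obtain ⟨-, x, hx⟩ := R.mem_mu_iff.1 hvL
  have hxr : x ∈ L.roots := R.mem_roots_iff.2 ⟨v, hvf, hx⟩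
  obtain ⟨s, t, hst, hcase⟩ := (exists_finsupp_pair_iff φ hαβ x).1 (hfs.2.2.2 x hxr)
  rw [← hst, map_add, map_integers_smul, map_integers_smul, hRβ, ← hRα, R.map_base] at hx
  have hx' := congrArg (RootLat.conj K) hx
  push_cast at hx hx'
  simp only [map_add, map_mul, map_neg, map_inv₀, AlgHom.commutes, map_one,
    conj_of_isOfFinOrder hvf, conj_of_isOfFinOrder hwf] at hx'
  -- Subtracting from `v = s - t w⁻¹` its conjugate isolates `t`, whose real value is `sin(π/(mp)) /
  -- sin(π/m)`. This lies strictly between zero and one, which no sign choice permits.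
  have hd : algebraMap K (AlgebraicClosure K) t * (w - (w : AlgebraicClosure K)⁻¹) =
      v - (v : AlgebraicClosure K)⁻¹ := by
    rw [← hx', ← hx, inv_inv]; ring
  have hsin := congrArg ι hd
  rw [map_mul, hι, map_sub_inv_eq_sin ι hιw, map_sub_inv_eq_sin ι hιv] at hsin
  have hI := Complex.I_ne_zero
  have hsin' : φ t * Real.sin (Real.pi / m) = Real.sin (Real.pi / (m * p : ℕ)) := by
    have : ((φ t * Real.sin (Real.pi / m) : ℝ) : ℂ) = (Real.sin (Real.pi / (m * p : ℕ)) : ℝ) := by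
      apply mul_left_cancel₀ (mul_ne_zero two_ne_zero hI)
      rw [← hsin]; push_cast; ring
    exact_mod_cast this
  have hs1 := sin_pi_div_pos (m := m) (by lia)
  have hs2 := sin_pi_div_pos (m := m * p) (by nlinarith)
  have hlt : Real.sin (Real.pi / (m * p : ℕ)) < Real.sin (Real.pi / m) := by
    have hpi := Real.pi_pos
    have hm0 : (3 : ℝ) ≤ m := by exact_mod_cast hm
    have hp0 : (1 : ℝ) < p := by exact_mod_cast hp1
    apply Real.sin_lt_sin_of_lt_of_le_pi_div_two
    · have : 0 ≤ Real.pi / (m * p : ℕ) := by positivity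
      linarith
    · exact div_le_div_of_nonneg_left hpi.le two_pos (by linarith)
    · push_cast
      exact div_lt_div_of_pos_left hpi (by linarith) (by nlinarith)
  rw [← hsin'] at hlt hs2
  have ht0 : 0 < φ t := by
    by_contra! h
    nlinarith
  have ht1 : φ t < 1 := by nlinarith
  rcases hcase with ⟨-, rfl | h⟩ | ⟨-, rfl | h⟩
  · simp at ht0
  · linarith
  · simp at ht0
  · rw [map_neg] at h; linarith

end Dihedral

/-! ### Existence of lattices of type `I₂(m)` -/

section DihedralExistence

variable {K : Type u} [Field K] [CharZero K] [Algebra.IsAlgebraic ℚ K]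
  [NumberField.IsTotallyReal K]

theorem RootLattice.Realization.mu_eq_zpowers_of_isMaximalInQ {L : RootLattice K}
    (R : L.Realization) {m : ℕ} (hm : m ∈ Q K) (hmax : IsMaximalInQ K m)
    {w : (AlgebraicClosure K)ˣ} (hw : IsPrimitiveRoot w (2 * m)) (hwL : w ∈ L.mu) :
    L.mu = Subgroup.zpowers w := by
  have hm1 := hm.1
  apply le_antisymm
  · intro g hg
    obtain ⟨N, hmN, hN, W, hW, hWp, -, j, rfl⟩ := exists_primitive_two_mul hwL hg (by lia) hw
      (R.isOfFinOrder_of_mem_mu hg)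
    have hNm := eq_of_isMaximalInQ hm hmax
      (R.mem_Q (lt_of_lt_of_le hm1 (Nat.le_of_dvd hN hmN)) hWp hW) hmN
    rw [hNm] at hWp
    obtain ⟨i, rfl⟩ := exists_pow_eq_of_primitive (by lia) hw hWp.pow_eq_one
    exact Subgroup.pow_mem _ (Subgroup.npow_mem_zpowers w i) j
  · rwa [Subgroup.zpowers_le]

/-- If `w = exp (iπ / m)` and `w ^ k = s - t w⁻¹`, then `s` and `t` are quotients of sines. -/
theorem mul_sin_eq_of_pow_eq (φ : K →+* ℝ) (ι : AlgebraicClosure K →+* ℂ)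
    (hι : ∀ x : K, ι (algebraMap K (AlgebraicClosure K) x) = φ x) {w : (AlgebraicClosure K)ˣ}
    (hwf : IsOfFinOrder w) {θ : ℝ} (hιw : ι w = Complex.exp (θ * Complex.I)) {s t : K} {k : ℕ}
    (h : (w : AlgebraicClosure K) ^ k = algebraMap K (AlgebraicClosure K) s -
      algebraMap K (AlgebraicClosure K) t * (w : AlgebraicClosure K)⁻¹) :
    φ s * Real.sin θ = Real.sin ((k + 1 : ℕ) * θ) ∧ φ t * Real.sin θ = Real.sin (k * θ) := by
  have hw0 := w.ne_zero
  have h' := congrArg (conj K) h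
  simp only [map_sub, map_mul, map_pow, map_inv₀, AlgHom.commutes,
    conj_of_isOfFinOrder hwf] at h'
  rw [inv_inv, inv_pow] at h'
  have hpow : ∀ j : ℕ, ι ((w : AlgebraicClosure K) ^ j) =
      Complex.exp ((j * θ : ℝ) * Complex.I) := fun j => by
    rw [map_pow, hιw, ← Complex.exp_nat_mul]
    push_cast
    ring_nf
  have key : ∀ (r : K) (j : ℕ), algebraMap K (AlgebraicClosure K) r *
      (w - (w : AlgebraicClosure K)⁻¹) =
        (w : AlgebraicClosure K) ^ j - ((w : AlgebraicClosure K) ^ j)⁻¹ →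
      φ r * Real.sin θ = Real.sin (j * θ) := by
    intro r j hr
    have hsin := congrArg ι hr
    rw [map_mul, hι, map_sub_inv_eq_sin ι hιw, map_sub_inv_eq_sin ι (hpow j)] at hsin
    have : ((φ r * Real.sin θ : ℝ) : ℂ) = (Real.sin (j * θ) : ℝ) := by
      apply mul_left_cancel₀ (mul_ne_zero two_ne_zero Complex.I_ne_zero)
      rw [← hsin]; push_cast; ring
    exact_mod_cast this
  constructor
  · apply key
    rw [pow_succ, mul_inv, h', h]
    field_simp
    ring
  · apply key
    rw [h', h]
    ring

theorem exists_isOfTypeI₂ [FiniteDimensional ℚ K] (φ : K →+* ℝ) {m : ℕ} (hm : 3 ≤ m)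
    (hmQ : m ∈ Q K) (hmp : IsPrimePow m ∨ IsMaximalInQ K m) :
    ∃ L : RootLattice K, L.Irreducible ∧ L.IsOfTypeI₂ φ m := by
  obtain ⟨ι, hι⟩ := exists_extension φ
  obtain ⟨w, hw, hιw⟩ := exists_primitive_exp ι (m := m) (by lia)
  have hwf := isOfFinOrder_of_primitive hw (by lia)
  obtain ⟨a, ha, haw, R, hR⟩ := exists_planeLattice_realization hmQ hw
  have hwL : w ∈ (planeLattice a ha).mu :=
    mem_mu_of_toFun_eq R (by lia) hw (x := ((0, 1) : 𝓞 K × 𝓞 K)) (by rw [hR]; simp)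
  have hmu : (planeLattice a ha).mu = Subgroup.zpowers w := by
    rcases hmp with hp | hmax
    · exact R.mu_eq_zpowers hp hw hwL fun x => ⟨_, _, hR x⟩
    · exact R.mu_eq_zpowers_of_isMaximalInQ hmQ hmax hw hwL
  let α : (planeLattice a ha).carrier := ((1, 0) : 𝓞 K × 𝓞 K)
  -- Realizes `-w⁻¹ = w - a`, since `a = w + w⁻¹`.
  let β : (planeLattice a ha).carrier := ((-a, 1) : 𝓞 K × 𝓞 K)
  have hlin : ∀ s t : 𝓞 K, s • α + t • β = ((s - t * a, t) : 𝓞 K × 𝓞 K) := fun s t => by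
    show s • ((1, 0) : 𝓞 K × 𝓞 K) + t • ((-a, 1) : 𝓞 K × 𝓞 K) = _
    ext <;> simp
    ring
  have hα : α ∈ (planeLattice a ha).roots := by
    show (planeLattice a ha).form α α = 2
    rw [planeLattice_form]; simp
  have hβ : β ∈ (planeLattice a ha).roots := by
    show (planeLattice a ha).form β β = 2
    rw [planeLattice_form]; simp; ring
  have hform : (planeLattice a ha).form α β = -a := by
    rw [planeLattice_form]; simp; ring
  have h1 : β ≠ α := fun h => by
    have : (1 : 𝓞 K) = 0 := congrArg Prod.snd h
    simp at this
  have h2 : β ≠ -α := fun h => by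
    have : (1 : 𝓞 K) = -0 := congrArg Prod.snd h
    simp at this
  have hφa : φ a = 2 * Real.cos (Real.pi / m) := by
    have := map_add_inv_eq_cos ι hιw
    rw [← haw, hι] at this
    exact_mod_cast this
  have hcos : 0 < Real.cos (Real.pi / m) := by
    have hpi := Real.pi_pos
    have hm0 : (3 : ℝ) ≤ m := by exact_mod_cast hm
    apply Real.cos_pos_of_mem_Ioo
    constructor
    · have : 0 < Real.pi / m := by positivity
      linarith
    · exact div_lt_div_of_pos_left hpi two_pos (by linarith)
  have ha0 : a ≠ 0 := by
    rintro rfl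
    simp at hφa
    exact hcos.ne' hφa
  refine ⟨planeLattice a ha, RootLattice.irreducible_of_form_ne_zero _ (planeLattice_rank a ha)
    hα hβ h1 h2 (by rw [hform]; exact neg_ne_zero.2 ha0), α, β, h1.symm, ?_, ?_⟩
  · obtain ⟨b, hb0, hb1⟩ := exists_basis_pair (R := 𝓞 K) (α := α) (β := β)
      (fun p q hpq => (planeLattice a ha).linearIndependent_of_roots hα hβ h1 h2 hpq)
      (fun x => ⟨x.1 + x.2 * a, x.2, by
        rw [hlin]
        show _ = ((x.1, x.2) : 𝓞 K × 𝓞 K)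
        ext <;> simp⟩)
    refine RootLattice.isFundamentalSystem_of_basis h1.symm hα hβ b hb0 hb1 fun x hx => ?_
    obtain ⟨u, huf, hxu⟩ := R.mem_roots_iff.1 hx
    have hu : u ∈ (planeLattice a ha).mu := R.mem_mu_iff.2 ⟨huf, x, hxu⟩
    have hne : NeZero (2 * m) := ⟨by lia⟩
    have hu1 : (u : AlgebraicClosure K) ^ (2 * m) = 1 := by
      rw [hmu] at hu
      obtain ⟨i, rfl⟩ := hu
      have : (w ^ i) ^ (2 * m) = 1 := by
        rw [← zpow_natCast, ← zpow_mul, mul_comm, zpow_mul, zpow_natCast, hw.pow_eq_one, one_zpow]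
      simpa using congrArg Units.val this
    obtain ⟨k, hk, hku⟩ := (IsPrimitiveRoot.coe_units_iff.2 hw).eq_pow_of_pow_eq_one hu1
    -- Rewriting `x.1 + x.2 w` with `w = a - w⁻¹` gives the coordinates with respect to `1` and
    -- `-w⁻¹`.
    set s : 𝓞 K := x.1 + x.2 * a with hs
    set t : 𝓞 K := x.2 with ht
    have hst : s • α + t • β = x := by
      rw [hlin]
      show _ = ((x.1, x.2) : 𝓞 K × 𝓞 K)
      ext <;> simp [hs, ht]
    have hpow : (w : AlgebraicClosure K) ^ k = algebraMap K (AlgebraicClosure K) s -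
        algebraMap K (AlgebraicClosure K) t * (w : AlgebraicClosure K)⁻¹ := by
      rw [hku, ← hxu, hR x]
      have : (s : K) = (x.1 : K) + (x.2 : K) * (a : K) := by simp [hs, ht]
      rw [this, map_add, map_mul, haw]
      ring
    obtain ⟨hsins, hsint⟩ := mul_sin_eq_of_pow_eq φ ι hι hwf hιw hpow
    refine ⟨s, t, hst, ?_⟩
    have hcast : ∀ r : 𝓞 K, (r : K) = 0 → r = 0 := fun r hr => by simpa using hr
    -- The roots `w ^ k` with `k < m` are the positive ones; a shift of `k` by `m` adds `π` to the
    -- angle and changes both signs.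
    rcases lt_or_ge k m with hkm | hkm
    · exact Or.inl ⟨(eq_zero_or_one_le_of_mul_sin φ (by lia) hkm hsins).imp (hcast s) id,
        (eq_zero_or_one_le_of_mul_sin φ (by lia) hkm.le hsint).imp (hcast t) id⟩
    · right
      obtain ⟨l, rfl⟩ := Nat.exists_eq_add_of_le hkm
      have hlm : l < m := by lia
      have hshift : ∀ j : ℕ, Real.sin ((m + j : ℕ) * (Real.pi / m)) =
          -Real.sin (j * (Real.pi / m)) := fun j => by
        have : (m : ℝ) ≠ 0 := by
          have : m ≠ 0 := by lia
          exact_mod_cast this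
        rw [← Real.sin_add_pi]
        congr 1
        push_cast
        field_simp
        ring
      rw [add_assoc, hshift] at hsins
      rw [hshift] at hsint
      have hs' : φ (-s) * Real.sin (Real.pi / m) = Real.sin ((l + 1 : ℕ) * (Real.pi / m)) := by
        rw [map_neg]; linarith
      have ht' : φ (-t) * Real.sin (Real.pi / m) = Real.sin (l * (Real.pi / m)) := by
        rw [map_neg]; linarith
      exact ⟨(eq_zero_or_one_le_of_mul_sin φ (by lia) hlm hs').imp
          (fun h => hcast s (neg_eq_zero.1 h)) id,
        (eq_zero_or_one_le_of_mul_sin φ (by lia) hlm.le ht').imp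
          (fun h => hcast t (neg_eq_zero.1 h)) id⟩
  · rw [hform, show ((-a : 𝓞 K) : K) = -(a : K) from map_neg _ _, map_neg, hφa]
    ring

end DihedralExistence

end RootLat

theorem mainTheorem2 (K : Type u) [Field K] [CharZero K] [Algebra.IsAlgebraic ℚ K]
    [NumberField.IsTotallyReal K] :
    -- every `μ(L)` is some `μ(C)`
    (∀ L : RootLat.RootLattice K, L.rank = 2 →
      ∃ C ∈ RootLat.setP K ∪ RootLat.setR K, L.mu = RootLat.muOf K C) ∧
    -- every `μ(C)` is some `μ(L)`
    (∀ C ∈ RootLat.setP K ∪ RootLat.setR K,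
      ∃ L : RootLat.RootLattice K, L.rank = 2 ∧ L.mu = RootLat.muOf K C) ∧
    -- `L ↦ μ(L)` is a bijection from the isomorphism classes onto the set of all `μ(C)`
    Set.BijOn (RootLat.RankTwoClasses.mu (K := K)) Set.univ
      (RootLat.muOf K '' (RootLat.setP K ∪ RootLat.setR K)) ∧
    -- `C ↦ μ(C)` is injective
    Set.InjOn (RootLat.muOf K) (RootLat.setP K ∪ RootLat.setR K) ∧
    -- lattices of type `I₂(m)` over number fields
    (FiniteDimensional ℚ K → ∀ φ : K →+* ℝ, ∀ m : ℕ, 3 ≤ m →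
      (m ∈ RootLat.Q K ↔ 2 * Real.cos (Real.pi / m) ∈ φ.range) ∧
      ((∃ L : RootLat.RootLattice K, L.Irreducible ∧ L.IsOfTypeI₂ φ m) ↔
        m ∈ RootLat.Q K ∧ (IsPrimePow m ∨ RootLat.IsMaximalInQ K m))) := by
  refine ⟨fun L hr => L.exists_mu_eq_muOf hr, fun C hC => RootLat.exists_lattice_mu_eq hC,
    RootLat.bijOn_mu, RootLat.muOf_injOn, fun _ φ m hm =>
      ⟨RootLat.mem_Q_iff_two_mul_cos_mem_range φ (by lia), ?_, ?_⟩⟩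
  · rintro ⟨L, -, hL⟩
    exact hL.mem_Q_and hm
  · rintro ⟨hQ, hp⟩
    exact RootLat.exists_isOfTypeI₂ φ hm hQ hp
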